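/- Let $A$ be a self-adjoint operator on a complex Hilbert space $\mathcal{H}$ that is bounded or semi-bounded from below. Let $\mathfrak{a}$ be its closed quadratic form (the closure of $(x,y)\mapsto\langle Ax,y\rangle$ on $\mathrm{Dom}(A)$), let $m=\min\sigma(A)$, and on $\mathrm{Dom}(\mathfrak{a})$ put $\|u\|_{\mathfrak{a}}=(\mathfrak{a}[u,u]-(m-1)\langle u,u\rangle)^{1/2}$. Let $a<b$ be real numbers in the resolvent set of $A$ such that $\Delta=[a,b]$ contains no point of $\sigma_{\mathrm{ess}}(A)$, where $\sigma_{\mathrm{ess}}(A)$ is $\sigma(A)$ without the isolated eigenvalues of finite multiplicity. Write $\sigma(A)\cap\Delta=\{\lambda_1,\dots,\lambda_d\}$ (eigenvalues repeated according to multiplicity), and let $\mathcal{L}(\Delta)$ be the span of the corresponding eigenvectors. Let $(\mathcal{L}_n)_{n\in\mathbb{N}}$ be finite-dimensional subspaces of $\mathrm{Dom}(\mathfrak{a})$ such that for every $u\in\mathrm{Dom}(\mathfrak{a})$ there are $u_n\in\mathcal{L}_n$ with $\|u-u_n\|_{\mathfrak{a}}\to0$. Let $\sigma(A,\mathcal{L}_n)$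 be the set of $\mu\in\mathbb{R}$ for which there is a non-zero $u\in\mathcal{L}_n$ with $\mathfrak{a}[u,v]=\mu\langle u,v\rangle$ for all $v\in\mathcal{L}_n$, and let $\mathcal{L}_n(\Delta)$ be the span of all such $u$ with $\mu\in\Delta$. For subspaces put $\delta(\mathcal{L},\mathcal{M})=\sup_{u\in\mathcal{L},\|u\|=1}\mathrm{dist}(u,\mathcal{M})$ (with $\sup\varnothing=0$) and $\hat\delta(\mathcal{L},\mathcal{M})=\max\{\delta(\mathcal{L},\mathcal{M}),\delta(\mathcal{M},\mathcal{L})\}$. Let $\delta_{\mathfrak{a}}$, $\hat\delta_{\mathfrak{a}}$ be the same quantities with $\|\cdot\|_{\mathfrak{a}}$ in place of $\|\cdot\|$, and let $d_H$ be the Hausdorff distance between subsets of $\mathbb{R}$ (with $d_H(\varnothing,\varnothing)=0$, and $d_H(\varnothing,S)=\infty$ for $S\neq\varnothing$). Suppose that spectral pollution does not occur in $\Delta$ for the sequence $(\mathcal{L}_n)$, that is, $\delta(\mathcal{L}_n(\Delta),\mathcal{L}(\Delta))\to0$. If $A$ is bounded, then $$\hat\delta(\mathcal{L}_n(\Delta),\mathcal{L}(\Delta))\to0\quad\text{and}\quad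 d_H(\sigma(A,\mathcal{L}_n)\cap\Delta,\{\lambda_1,\dots,\lambda_d\})\to0.$$ If $A$ is semi-bounded from below, then $$\hat\delta_{\mathfrak{a}}(\mathcal{L}_n(\Delta),\mathcal{L}(\Delta))\to0\quad\text{and}\quad d_H(\sigma(A,\mathcal{L}_n)\cap\Delta,\{\lambda_1,\dots,\lambda_d\})\to0.$$ -/

import Mathlib

open Filter Topology

namespace Galerkin

variable {H : Type*} [NormedAddCommGroup H] [InnerProductSpace ℂ H]

/-! ### Spectrum of a (possibly unbounded) operator -/

/-- `A` is bounded. A bounded self-adjoint operator is automatically defined on all of `H`. -/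
def IsBddOp (A : H →ₗ.[ℂ] H) : Prop :=
  ∃ C : ℝ, ∀ x : A.domain, ‖A x‖ ≤ C * ‖(x : H)‖

/-- `A` is semi-bounded (from below): `⟨Ax, x⟩ ≥ γ ‖x‖²` on the domain of `A`, for some real `γ`. -/
def IsSemibddOp (A : H →ₗ.[ℂ] H) : Prop :=
  ∃ γ : ℝ, ∀ x : A.domain, γ * ‖(x : H)‖ ^ 2 ≤ (inner ℂ (A x) (x : H)).re

/-- The resolvent set: `A - ζ : Dom(A) → H` has a bounded everywhere defined inverse `R`. -/
def resolvent (A : H →ₗ.[ℂ] H) : Set ℂ :=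
  {ζ | ∃ R : H →L[ℂ] H,
    (∀ y : H, ∃ h : R y ∈ A.domain, A ⟨R y, h⟩ - ζ • R y = y) ∧
    (∀ x : A.domain, R (A x - ζ • (x : H)) = x)}

/-- The spectrum `σ(A)`. -/
def opSpectrum (A : H →ₗ.[ℂ] H) : Set ℂ := (resolvent A)ᶜ

/-- The spectrum as a set of real numbers (for self-adjoint `A` this is all of the spectrum). -/
def realSpectrum (A : H →ₗ.[ℂ] H) : Set ℝ := {t | (t : ℂ) ∈ opSpectrum A}

/-- `ker (A - ζ)`, as a subspace of `H`. -/
def eigenspace (A : H →ₗ.[ℂ] H) (ζ : ℂ) : Submodule ℂ H :=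
  (LinearMap.ker (A.toFun - ζ • A.domain.subtype)).map A.domain.subtype

/-- The discrete spectrum: isolated points of the spectrum that are eigenvalues of finite
multiplicity. -/
def discreteSpectrum (A : H →ₗ.[ℂ] H) : Set ℂ :=
  {ζ | ζ ∈ opSpectrum A ∧ (∃ ε > 0, ∀ z ∈ opSpectrum A, ‖z - ζ‖ < ε → z = ζ) ∧
    eigenspace A ζ ≠ ⊥ ∧ FiniteDimensional ℂ (eigenspace A ζ)}

/-- The essential spectrum: the complement in the spectrum of the discrete spectrum. -/
def essSpectrum (A : H →ₗ.[ℂ] H) : Set ℂ := opSpectrum A \ discreteSpectrum A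

/-- The eigenspace `L(Δ)` associated to `σ(A) ∩ Δ`. -/
def spectralSubspace (A : H →ₗ.[ℂ] H) (Δ : Set ℝ) : Submodule ℂ H :=
  ⨆ t ∈ realSpectrum A ∩ Δ, eigenspace A (t : ℂ)

/-! ### The closed form of a semi-bounded self-adjoint operator

It is the closure of the form `(x, y) ↦ ⟨Ax, y⟩` on `Dom(A)`. -/

/-- `x n ∈ Dom(A)`, `x n → u` in `H`, and `⟨A (x n - x m), x n - x m⟩ → 0` as `n, m → ∞`. -/
def FormApprox (A : H →ₗ.[ℂ] H) (x : ℕ → A.domain) (u : H) : Prop :=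
  Tendsto (fun n => (x n : H)) atTop (𝓝 u) ∧
  Tendsto (fun p : ℕ × ℕ => inner ℂ (A (x p.1 - x p.2)) ((x p.1 - x p.2 : A.domain) : H))
    atTop (𝓝 0)

/-- The form domain `Dom(𝔞)`. -/
def formDomain (A : H →ₗ.[ℂ] H) : Set H := {u | ∃ x : ℕ → A.domain, FormApprox A x u}

open Classical in
/-- The form `𝔞[u, v] = lim ⟨A xₙ, yₙ⟩` for `u, v` in the form domain, where `xₙ`, `yₙ` are
approximating sequences of `u`, `v`; it does not depend on them, see `tendsto_form`.
The value is `0` when `u` or `v` is not in the form domain. -/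
noncomputable def form (A : H →ₗ.[ℂ] H) (u v : H) : ℂ :=
  if h : u ∈ formDomain A ∧ v ∈ formDomain A then
    limUnder atTop (fun n => inner ℂ (A (h.1.choose n)) (h.2.choose n : H))
  else 0

/-- `m = min σ(A)`. -/
noncomputable def specMin (A : H →ₗ.[ℂ] H) : ℝ := sInf (realSpectrum A)

/-- `⟨u, v⟩_𝔞 = 𝔞[u, v] - (m - 1) ⟨u, v⟩`. -/
noncomputable def formInner (A : H →ₗ.[ℂ] H) (u v : H) : ℂ :=
  form A u v - ((specMin A - 1 : ℝ) : ℂ) * inner ℂ u v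

/-- `‖u‖_𝔞`, for `u` in the form domain. -/
noncomputable def formNorm (A : H →ₗ.[ℂ] H) (u : H) : ℝ := Real.sqrt (formInner A u u).re

/-! ### Galerkin eigenvalues and eigenspaces -/

/-- `u ∈ L` satisfies `𝔞[u, v] = μ ⟨u, v⟩` for all `v ∈ L`. -/
def IsGalerkinSol (A : H →ₗ.[ℂ] H) (L : Submodule ℂ H) (μ : ℝ) (u : H) : Prop :=
  u ∈ L ∧ ∀ v ∈ L, form A u v = (μ : ℂ) * inner ℂ u v

/-- The Galerkin eigenvalues `σ(A, L)`. -/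
def galerkinSpectrum (A : H →ₗ.[ℂ] H) (L : Submodule ℂ H) : Set ℝ :=
  {μ | ∃ u : H, u ≠ 0 ∧ IsGalerkinSol A L μ u}

/-- The Galerkin eigenspace `L(Δ)` of the trial space `L`, corresponding to `σ(A, L) ∩ Δ`. -/
def galerkinSubspace (A : H →ₗ.[ℂ] H) (L : Submodule ℂ H) (Δ : Set ℝ) : Submodule ℂ H :=
  Submodule.span ℂ {u | ∃ μ ∈ galerkinSpectrum A L ∩ Δ, IsGalerkinSol A L μ u}

/-! ### Gaps between subspaces -/

/-- `δ(L, M) = sup {dist(u, M) : u ∈ L, N u = 1}`, where lengths and distances are measured with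
`N`. The supremum over the empty set is `0`. -/
noncomputable def semiGap (N : H → ℝ) (L M : Submodule ℂ H) : ℝ :=
  sSup {r | ∃ u ∈ L, N u = 1 ∧ r = ⨅ v : M, N (u - v)}

/-- The gap `max (δ(L, M)) (δ(M, L))`. -/
noncomputable def gap (N : H → ℝ) (L M : Submodule ℂ H) : ℝ :=
  max (semiGap N L M) (semiGap N M L)

/-- Spectral pollution occurs in `Δ` for the trial spaces `(L n)`: `δ(L n (Δ), L(Δ))`, in the norm
of `H`, does not converge to zero. -/
def SpectralPollution (A : H →ₗ.[ℂ] H) (L : ℕ → Submodule ℂ H) (Δ : Set ℝ) : Prop :=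
  ¬ Tendsto (fun n => semiGap (fun u : H => ‖u‖) (galerkinSubspace A (L n) Δ)
    (spectralSubspace A Δ)) atTop (𝓝 0)

/-! ### The form is well defined -/

section WellDefined

variable {A : H →ₗ.[ℂ] H}

/-- The shifted form on `Dom(A)`, as a semi-inner product. -/
@[reducible] noncomputable def shiftCore {γ : ℝ} (hs : A.IsFormalAdjoint A)
    (hγ : ∀ x : A.domain, γ * ‖(x : H)‖ ^ 2 ≤ (inner ℂ (A x) (x : H)).re) :
    PreInnerProductSpace.Core ℂ A.domain where
  inner x y := inner ℂ (A x) (y : H) - (γ : ℂ) * inner ℂ (x : H) (y : H)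
  conj_inner_symm x y := by
    have := hs x y
    simp [this]
  re_inner_nonneg x := by
    have h := hγ x
    have h2 : inner ℂ (x : H) (x : H) = ((‖(x : H)‖ ^ 2 : ℝ) : ℂ) := by
      rw [inner_self_eq_norm_sq_to_K]; norm_cast
    simp only [h2, ← Complex.ofReal_mul, map_sub, RCLike.re_to_complex, Complex.ofReal_re]
    linarith
  add_left x y z := by
    simp only [A.map_add, Submodule.coe_add, inner_add_left]; ring
  smul_left x y r := by
    simp only [A.map_smul, Submodule.coe_smul, inner_smul_left]; ring

theorem tendsto_inner_of_formApprox {γ : ℝ} (hs : A.IsFormalAdjoint A)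
    (hγ : ∀ x : A.domain, γ * ‖(x : H)‖ ^ 2 ≤ (inner ℂ (A x) (x : H)).re)
    {x x' y y' : ℕ → A.domain} {u v : H} (hx : FormApprox A x u) (hx' : FormApprox A x' u)
    (hy : FormApprox A y v) (hy' : FormApprox A y' v) :
    ∃ l : ℂ, Tendsto (fun n => inner ℂ (A (x n)) (y n : H)) atTop (𝓝 l) ∧
      Tendsto (fun n => inner ℂ (A (x' n)) (y' n : H)) atTop (𝓝 l) := by
  let B : A.domain → A.domain → ℂ :=
    fun x y => inner ℂ (A x) (y : H) - (γ : ℂ) * inner ℂ (x : H) (y : H)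
  let N : A.domain → ℝ := fun z => Real.sqrt (B z z).re
  have hCS : ∀ x y, ‖B x y‖ ≤ N x * N y := fun x y => by
    let _ := shiftCore hs hγ
    exact InnerProductSpace.Core.norm_inner_le_norm (𝕜 := ℂ) x y
  have hpos : ∀ z, 0 ≤ (B z z).re := fun z => (shiftCore hs hγ).re_inner_nonneg z
  have hN0 : ∀ z, 0 ≤ N z := fun z => Real.sqrt_nonneg _
  have hNsq : ∀ z, N z ^ 2 = (B z z).re := fun z => Real.sq_sqrt (hpos z)
  have hBsubl : ∀ a b c, B (a - b) c = B a c - B b c := fun a b c => by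
    simp only [B, A.map_sub, Submodule.coe_sub, inner_sub_left]; ring
  have hBsubr : ∀ a b c, B c (a - b) = B c a - B c b := fun a b c => by
    simp only [B, Submodule.coe_sub, inner_sub_right]; ring
  have hBaddl : ∀ a b c, B (a + b) c = B a c + B b c := fun a b c => by
    simp only [B, A.map_add, Submodule.coe_add, inner_add_left]; ring
  have hBaddr : ∀ a b c, B c (a + b) = B c a + B c b := fun a b c => by
    simp only [B, Submodule.coe_add, inner_add_right]; ring
  have hre : ∀ a b, (B a b).re ≤ N a * N b := fun a b => (Complex.re_le_norm _).trans (hCS a b)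
  have htri : ∀ a b, N (a + b) ≤ N a + N b := fun a b => by
    refine abs_le_of_sq_le_sq' ?_ (add_nonneg (hN0 a) (hN0 b)) |>.2
    rw [hNsq, hBaddl, hBaddr, hBaddr]
    have h1 := hre a b
    have h2 := hre b a
    have h3 := hNsq a
    have h4 := hNsq b
    simp only [Complex.add_re]
    nlinarith
  -- approximating sequences are Cauchy for the seminorm
  have hC : ∀ {x : ℕ → A.domain} {u : H}, FormApprox A x u →
      Tendsto (fun p : ℕ × ℕ => N (x p.1 - x p.2)) atTop (𝓝 0) := by
    intro x u hx
    have h1 : Tendsto (fun p : ℕ × ℕ => ((x p.1 - x p.2 : A.domain) : H)) atTop (𝓝 (u - u)) := by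
      simp only [Submodule.coe_sub]
      rw [← prod_atTop_atTop_eq]
      exact (hx.1.comp tendsto_fst).sub (hx.1.comp tendsto_snd)
    have h2 : Tendsto (fun p : ℕ × ℕ => B (x p.1 - x p.2) (x p.1 - x p.2)) atTop
        (𝓝 (0 - (γ : ℂ) * inner ℂ (u - u) (u - u))) :=
      hx.2.sub ((h1.inner h1).const_mul _)
    have h3 := (Complex.continuous_re.tendsto _).comp h2
    have h4 := (Real.continuous_sqrt.tendsto _).comp h3
    simpa [N, Function.comp_def] using h4
  have hbd : ∀ {x : ℕ → A.domain} {u : H}, FormApprox A x u →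
      ∃ K, 0 ≤ K ∧ ∃ n₀, ∀ n ≥ n₀, N (x n) ≤ K := by
    intro x u hx
    have h := (hC hx).eventually (gt_mem_nhds (zero_lt_one))
    rw [eventually_atTop] at h
    obtain ⟨⟨p, q⟩, h⟩ := h
    refine ⟨1 + N (x q), by linarith [hN0 (x q)], p, fun n hn => ?_⟩
    have h5 := h (n, q) ⟨hn, le_rfl⟩
    have h6 := htri (x n - x q) (x q)
    simp only [sub_add_cancel] at h6
    simp only at h5
    linarith
  -- difference of two approximating sequences
  have hdiff : ∀ {x x' : ℕ → A.domain} {u : H}, FormApprox A x u → FormApprox A x' u →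
      Tendsto (fun n => N (x n - x' n)) atTop (𝓝 0) := by
    intro x x' u hx hx'
    obtain ⟨K, hK, n₀, hKn⟩ := hbd hx
    obtain ⟨K', hK', n₁, hKn'⟩ := hbd hx'
    have hNneg : ∀ a b, N (a - b) = N (b - a) := fun a b => by
      simp only [N]; rw [hBsubl, hBsubr, hBsubr, hBsubl, hBsubr, hBsubr]; congr 2; ring
    have hz0 : N 0 = 0 := by simp [N, B]
    have htrs : ∀ a b, N (a - b) ≤ N a + N b := fun a b => by
      have h1 := htri a (0 - b)
      rw [hNneg 0 b] at h1
      simpa [sub_eq_add_neg] using h1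
    rw [Metric.tendsto_atTop]
    intro ε hε
    have hη : 0 < ε ^ 2 / (2 * (K + K' + 1)) := by positivity
    have h1 : ∀ᶠ p : ℕ × ℕ in atTop,
        N (x p.1 - x p.2) + N (x' p.1 - x' p.2) < ε ^ 2 / (2 * (K + K' + 1)) := by
      have := (hC hx).add (hC hx')
      rw [add_zero] at this
      exact this.eventually (gt_mem_nhds hη)
    rw [eventually_atTop] at h1
    obtain ⟨⟨p, q⟩, h1⟩ := h1
    refine ⟨max p (max n₀ n₁), fun n hn => ?_⟩
    have hnp : p ≤ n := (le_max_left _ _).trans hn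
    have hn0 : n₀ ≤ n := (le_max_left _ _).trans ((le_max_right _ _).trans hn)
    have hn1 : n₁ ≤ n := (le_max_right _ _).trans ((le_max_right _ _).trans hn)
    have hzt : Tendsto (fun k => ((x k - x' k : A.domain) : H)) atTop (𝓝 (u - u)) := by
      simpa using hx.1.sub hx'.1
    have hBt : Tendsto (fun k => B (x n - x' n) (x k - x' k)) atTop (𝓝 0) := by
      have ha : Tendsto (fun k => inner ℂ (A (x n - x' n)) ((x k - x' k : A.domain) : H)) atTop
          (𝓝 (inner ℂ (A (x n - x' n)) (u - u))) := tendsto_const_nhds.inner hzt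
      have hb : Tendsto (fun k => inner ℂ ((x n - x' n : A.domain) : H)
          ((x k - x' k : A.domain) : H)) atTop
          (𝓝 (inner ℂ ((x n - x' n : A.domain) : H) (u - u))) := tendsto_const_nhds.inner hzt
      have := ha.sub (hb.const_mul (γ : ℂ))
      simpa [B] using this
    have h2 := hBt.norm.eventually (gt_mem_nhds (show ‖(0 : ℂ)‖ < ε ^ 2 / 2 by
      rw [norm_zero]; positivity))
    obtain ⟨k, hk, hkq⟩ := (h2.and (eventually_ge_atTop q)).exists
    have h3 := h1 (n, k) ⟨hnp, hkq⟩
    simp only at h3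
    have hNn : N (x n - x' n) ≤ K + K' := (htrs _ _).trans (add_le_add (hKn n hn0) (hKn' n hn1))
    have h4 : N ((x n - x' n) - (x k - x' k)) ≤ ε ^ 2 / (2 * (K + K' + 1)) := by
      have : (x n - x' n) - (x k - x' k) = (x n - x k) - (x' n - x' k) := by abel
      rw [this]
      exact (htrs _ _).trans h3.le
    have h5 : N (x n - x' n) ^ 2 = (B (x n - x' n) ((x n - x' n) - (x k - x' k))).re
        + (B (x n - x' n) (x k - x' k)).re := by
      have h := hBsubr (x n - x' n) (x k - x' k) (x n - x' n)
      have hh : ∀ s t : ℂ, s.re = (s - t).re + t.re := fun s t => by simp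
      rw [hNsq, h]
      exact hh _ _
    have h6 := hre (x n - x' n) ((x n - x' n) - (x k - x' k))
    have h7 := (Complex.re_le_norm _).trans_lt hk
    have h8 : N (x n - x' n) * N ((x n - x' n) - (x k - x' k)) ≤
        (K + K' + 1) * (ε ^ 2 / (2 * (K + K' + 1))) :=
      mul_le_mul (by linarith) h4 (hN0 _) (by positivity)
    have h9 : (K + K' + 1) * (ε ^ 2 / (2 * (K + K' + 1))) = ε ^ 2 / 2 := by field_simp
    have h10 : N (x n - x' n) ^ 2 < ε ^ 2 := by rw [h5]; linarith
    rw [Real.dist_eq, sub_zero, abs_of_nonneg (hN0 _)]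
    exact lt_of_pow_lt_pow_left₀ 2 hε.le h10
  have hbilin : ∀ a b c d, ‖B a b - B c d‖ ≤ N (a - c) * N b + N c * N (b - d) := by
    intro a b c d
    have : B a b - B c d = B (a - c) b + B c (b - d) := by rw [hBsubl, hBsubr]; ring
    rw [this]
    exact (norm_add_le _ _).trans (add_le_add (hCS _ _) (hCS _ _))
  obtain ⟨Kx, hKx, nx, hx1⟩ := hbd hx
  obtain ⟨Kx', hKx', nx', hx1'⟩ := hbd hx'
  obtain ⟨Ky, hKy, ny, hy1⟩ := hbd hy
  -- convergence of the shifted form along the first pair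
  have hcau : CauchySeq (fun n => B (x n) (y n)) := by
    rw [cauchySeq_iff_tendsto_dist_atTop_0]
    have hlim : Tendsto (fun p : ℕ × ℕ => N (x p.1 - x p.2) * Ky + Kx * N (y p.1 - y p.2)) atTop
        (𝓝 0) := by
      simpa using ((hC hx).mul_const Ky).add ((hC hy).const_mul Kx)
    refine squeeze_zero' (Eventually.of_forall fun _ => dist_nonneg) ?_ hlim
    filter_upwards [eventually_ge_atTop ((ny, nx) : ℕ × ℕ)] with p hp
    rw [dist_eq_norm]
    refine (hbilin _ _ _ _).trans (add_le_add ?_ ?_)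
    · exact mul_le_mul_of_nonneg_left (hy1 _ hp.1) (hN0 _)
    · exact mul_le_mul_of_nonneg_right (hx1 _ hp.2) (hN0 _)
  obtain ⟨l, hl⟩ := cauchySeq_tendsto_of_complete hcau
  have hl' : Tendsto (fun n => B (x' n) (y' n)) atTop (𝓝 l) := by
    have hd : Tendsto (fun n => B (x n) (y n) - B (x' n) (y' n)) atTop (𝓝 0) := by
      have hlim : Tendsto (fun n => N (x n - x' n) * Ky + Kx' * N (y n - y' n)) atTop (𝓝 0) := by
        simpa using ((hdiff hx hx').mul_const Ky).add ((hdiff hy hy').const_mul Kx')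
      refine squeeze_zero_norm' ?_ hlim
      filter_upwards [eventually_ge_atTop ny, eventually_ge_atTop nx'] with n hn hn'
      refine (hbilin _ _ _ _).trans (add_le_add ?_ ?_)
      · exact mul_le_mul_of_nonneg_left (hy1 _ hn) (hN0 _)
      · exact mul_le_mul_of_nonneg_right (hx1' _ hn') (hN0 _)
    simpa using hl.sub hd
  refine ⟨l + γ * inner ℂ u v, ?_, ?_⟩
  · simpa [B] using hl.add ((hx.1.inner hy.1).const_mul (γ : ℂ))
  · simpa [B] using hl'.add ((hx'.1.inner hy'.1).const_mul (γ : ℂ))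

variable [CompleteSpace H]

theorem isFormalAdjoint_self (hA : IsSelfAdjoint A) : A.IsFormalAdjoint A := by
  have h := LinearPMap.adjoint_isFormalAdjoint (T := A) hA.dense_domain
  rwa [LinearPMap.isSelfAdjoint_def.1 hA] at h

/-- The value `𝔞[u, v]` is the limit of `⟨A xₙ, yₙ⟩` for all approximating sequences. -/
theorem tendsto_form (hA : IsSelfAdjoint A) (hb : IsSemibddOp A) {x y : ℕ → A.domain} {u v : H}
    (hx : FormApprox A x u) (hy : FormApprox A y v) :
    Tendsto (fun n => inner ℂ (A (x n)) (y n : H)) atTop (𝓝 (form A u v)) := by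
  obtain ⟨γ, hγ⟩ := hb
  have h : u ∈ formDomain A ∧ v ∈ formDomain A := ⟨⟨x, hx⟩, ⟨y, hy⟩⟩
  obtain ⟨l, h1, h2⟩ := tendsto_inner_of_formApprox (isFormalAdjoint_self hA) hγ hx
    h.1.choose_spec hy h.2.choose_spec
  rw [form, dif_pos h, h2.limUnder_eq]
  exact h1

/-- On `Dom(A)` the form is `⟨Ax, y⟩`. -/
theorem form_coe (hA : IsSelfAdjoint A) (hb : IsSemibddOp A) (x y : A.domain) :
    form A (x : H) (y : H) = inner ℂ (A x) (y : H) := by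
  have hc : ∀ z : A.domain, FormApprox A (fun _ => z) (z : H) := fun z =>
    ⟨tendsto_const_nhds, by simp⟩
  exact tendsto_nhds_unique (tendsto_form hA hb (hc x) (hc y)) tendsto_const_nhds

end WellDefined

end Galerkin

/-!
A bounded self-adjoint operator is semi-bounded, so let `A` be semi-bounded, put `c = m - 1` with
`m = min σ(A)`, and let `S` be the positive square root of the resolvent `(A - c)⁻¹`, which exists
because `m` is a lower bound of the numerical range (`Galerkin.specMin_mul_le`). Then `S` is a
bijection from `H` onto the form domain, and `𝔞[S f, S g] = ⟨f, g⟩ + c ⟨S f, S g⟩`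
(`Galerkin.IsResolventSqrt.form_apply`); in particular `‖S f‖_𝔞 = ‖f‖`. Under this isometry the
Galerkin problem on `L n` becomes the eigenvalue problem `P S² f = (μ - c)⁻¹ f`, `P` being the
orthogonal projection onto `M n = S⁻¹ (L n)`, for the compression of the *bounded* operator `S²` to
`M n`. These projections converge strongly to the identity as `n → ∞`, and `L(Δ)` is a finite-dimensional `S`-invariant space of eigenvectors of `S²`.

Three estimates give the theorem.

* `L(Δ)` is asymptotically contained in `L n (Δ)` in the form norm. If `S² u = ν u`, then `P u` has a
  small residual for the compression, so all but a small part of it is a sum of eigenvectors with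
  eigenvalues near `ν` (`Galerkin.exists_mem_iSup_eigenspace`); as `a` and `b` lie in the resolvent
  set, these belong to `Δ`. This needs no assumption on pollution, and it also shows that every
  point of `σ(A) ∩ Δ` is a limit of Galerkin eigenvalues.
* `L n (Δ)` is asymptotically contained in `L(Δ)` in the form norm. The absence of pollution gives
  this in the norm of `H`. On `L n (Δ)` the form norm is at most a constant times the norm of `H`,
  uniformly in `n`, since the Galerkin eigenvalues there are at most `b`. Given `u ∈ L n (Δ)`, take
  `v ∈ L(Δ)` close to `u` in `H`, and by the first estimate `w ∈ L n (Δ)` close to `v` in the form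
  norm; then `u - w ∈ L n (Δ)` is small in `H`, hence in the form norm
  (`Galerkin.IsResolventSqrt.asympContained_comap`).
* Galerkin eigenvalues in `Δ` are uniformly close to `σ(A) ∩ Δ`. By the second estimate a Galerkin
  eigenvector is close to a vector of `L(Δ)`, which is then an approximate eigenvector of the
  restriction of `S²` to `L(Δ)`
  (`Galerkin.IsResolventSqrt.eventually_exists_mem_realSpectrum`).
-/

namespace Galerkin

/-! ### Self-adjoint operators bounded from below -/

section Operator

variable {H : Type*} [NormedAddCommGroup H] [InnerProductSpace ℂ H] [CompleteSpace H]
  {A : H →ₗ.[ℂ] H}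

omit [CompleteSpace H] in
theorem inner_self_eq_ofReal (u : H) : inner ℂ u u = ((‖u‖ ^ 2 : ℝ) : ℂ) := by
  rw [inner_self_eq_norm_sq_to_K]; norm_cast

/-- A self-adjoint operator is its own largest formal adjoint. -/
theorem exists_mem_domain_of_forall_inner (hA : IsSelfAdjoint A) {y w : H}
    (h : ∀ x : A.domain, inner ℂ w (x : H) = inner ℂ y (A x)) :
    ∃ hy : y ∈ A.domain, A ⟨y, hy⟩ = w := by
  have key : ∀ B : H →ₗ.[ℂ] H, A.adjoint = B → ∃ hy : y ∈ B.domain, B ⟨y, hy⟩ = w := by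
    rintro _ rfl
    exact ⟨LinearPMap.mem_adjoint_domain_of_exists y ⟨w, h⟩,
      LinearPMap.adjoint_apply_eq hA.dense_domain _ h⟩
  exact key A (LinearPMap.isSelfAdjoint_def.1 hA)

/-- A self-adjoint operator is closed. -/
theorem exists_mem_domain_of_tendsto (hA : IsSelfAdjoint A) {x : ℕ → A.domain} {u y : H}
    (hx : Tendsto (fun n => (x n : H)) atTop (𝓝 u))
    (hy : Tendsto (fun n => A (x n)) atTop (𝓝 y)) :
    ∃ hu : u ∈ A.domain, A ⟨u, hu⟩ = y := by
  refine exists_mem_domain_of_forall_inner hA fun z => ?_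
  have h1 : Tendsto (fun n => inner ℂ (A (x n)) (z : H)) atTop (𝓝 (inner ℂ y (z : H))) :=
    hy.inner tendsto_const_nhds
  have h2 : Tendsto (fun n => inner ℂ (x n : H) (A z)) atTop (𝓝 (inner ℂ u (A z))) :=
    hx.inner tendsto_const_nhds
  exact tendsto_nhds_unique h1 (by simpa only [isFormalAdjoint_self hA _ z] using h2)

omit [CompleteSpace H] in
theorem mul_norm_le_norm_sub_smul {γ t : ℝ}
    (hγ : ∀ x : A.domain, γ * ‖(x : H)‖ ^ 2 ≤ (inner ℂ (A x) (x : H)).re) (x : A.domain) :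
    (γ - t) * ‖(x : H)‖ ≤ ‖A x - (t : ℂ) • (x : H)‖ := by
  rcases (norm_nonneg (x : H)).eq_or_lt with h0 | h0
  · rw [← h0]; simp
  have h1 := (Complex.re_le_norm _).trans
    (norm_inner_le_norm (𝕜 := ℂ) (A x - (t : ℂ) • (x : H)) (x : H))
  rw [inner_sub_left, inner_smul_left, inner_self_eq_ofReal, Complex.conj_ofReal,
    ← Complex.ofReal_mul,
    Complex.sub_re, Complex.ofReal_re] at h1
  have h3 := hγ x
  refine le_of_mul_le_mul_right ?_ h0
  nlinarith

/-- Below a lower bound of its numerical range a self-adjoint operator has no spectrum. -/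
theorem mem_resolvent_of_lt (hA : IsSelfAdjoint A) {γ t : ℝ}
    (hγ : ∀ x : A.domain, γ * ‖(x : H)‖ ^ 2 ≤ (inner ℂ (A x) (x : H)).re) (ht : t < γ) :
    (t : ℂ) ∈ resolvent A := by
  have hδ : 0 < γ - t := sub_pos.2 ht
  let D : A.domain →ₗ[ℂ] H := A.toFun - (t : ℂ) • A.domain.subtype
  have hD : ∀ x, D x = A x - (t : ℂ) • (x : H) := fun x => rfl
  have hbd : ∀ x : A.domain, ‖(x : H)‖ ≤ (γ - t)⁻¹ * ‖D x‖ := fun x => by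
    rw [inv_mul_eq_div, le_div_iff₀ hδ, mul_comm]
    exact mul_norm_le_norm_sub_smul hγ x
  have hinj : Function.Injective D := by
    rw [← LinearMap.ker_eq_bot, LinearMap.ker_eq_bot']
    intro x hx
    have := hbd x
    rw [hx, norm_zero, mul_zero] at this
    exact Subtype.ext (norm_le_zero_iff.1 this)
  have hclosed : IsClosed (LinearMap.range D : Set H) := by
    refine IsSeqClosed.isClosed fun y z hy hyz => ?_
    choose x hx using hy
    have hcau : CauchySeq (fun n => (x n : H)) := by
      have h1 := hyz.cauchySeq
      rw [cauchySeq_iff_tendsto_dist_atTop_0] at h1 ⊢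
      refine squeeze_zero (fun _ => dist_nonneg) (fun p => ?_)
        (by simpa using h1.const_mul (γ - t)⁻¹)
      rw [dist_eq_norm, dist_eq_norm, ← hx, ← hx, ← map_sub]
      exact hbd (x p.1 - x p.2)
    obtain ⟨u, hu⟩ := cauchySeq_tendsto_of_complete hcau
    obtain ⟨hmem, hAu⟩ := exists_mem_domain_of_tendsto hA (y := z + (t : ℂ) • u) hu (by
      refine (hyz.add (hu.const_smul (t : ℂ))).congr fun n => ?_
      rw [← hx, hD, sub_add_cancel])
    exact ⟨⟨u, hmem⟩, by rw [hD, hAu, add_sub_cancel_right]⟩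
  have hperp : (LinearMap.range D)ᗮ = ⊥ := by
    rw [Submodule.eq_bot_iff]
    intro z hz
    obtain ⟨hmem, hAz⟩ := exists_mem_domain_of_forall_inner hA (y := z) (w := (t : ℂ) • z)
      fun x => by
        have h := Submodule.inner_left_of_mem_orthogonal (LinearMap.mem_range_self D x) hz
        rw [hD, inner_sub_right, inner_smul_right, sub_eq_zero] at h
        rw [inner_smul_left, Complex.conj_ofReal, h]
    have : (⟨z, hmem⟩ : A.domain) = 0 := hinj (by rw [hD, hAz, sub_self, map_zero])
    exact congrArg Subtype.val this
  have hsurj : Function.Surjective D := by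
    have : CompleteSpace (LinearMap.range D) := hclosed.completeSpace_coe
    exact LinearMap.range_eq_top.1 ((Submodule.orthogonal_eq_bot_iff).1 hperp)
  let e := LinearEquiv.ofBijective D ⟨hinj, hsurj⟩
  have he : ∀ y, D (e.symm y) = y := fun y => e.apply_symm_apply y
  refine ⟨(A.domain.subtype ∘ₗ e.symm.toLinearMap).mkContinuous (γ - t)⁻¹ fun y => ?_,
    fun y => ⟨(e.symm y).2, he y⟩, fun x => ?_⟩
  · have := hbd (e.symm y)
    rwa [he] at this
  · exact congrArg Subtype.val (e.symm_apply_apply x)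

theorem isPositive_of_resolvent (hA : IsSelfAdjoint A) {γ t : ℝ}
    (hγ : ∀ x : A.domain, γ * ‖(x : H)‖ ^ 2 ≤ (inner ℂ (A x) (x : H)).re) (ht : t ≤ γ)
    {R : H →L[ℂ] H} (hR : ∀ y : H, ∃ h : R y ∈ A.domain, A ⟨R y, h⟩ - (t : ℂ) • R y = y) :
    R.IsPositive := by
  choose hmem hR using hR
  refine ⟨fun y z => ?_, fun y => ?_⟩
  · have h := isFormalAdjoint_self hA ⟨R y, hmem y⟩ ⟨R z, hmem z⟩
    conv_lhs => rw [← hR z]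
    conv_rhs => rw [← hR y]
    simp only [ContinuousLinearMap.coe_coe, inner_sub_left, inner_sub_right, inner_smul_left,
      inner_smul_right, Complex.conj_ofReal, h]
  · have h := hγ ⟨R y, hmem y⟩
    have h3 : inner ℂ (R y) y = inner ℂ (R y) (A ⟨R y, hmem y⟩) - t * inner ℂ (R y) (R y) := by
      rw [← inner_smul_right, ← inner_sub_right, hR y]
    have h4 := isFormalAdjoint_self hA ⟨R y, hmem y⟩ ⟨R y, hmem y⟩
    rw [ContinuousLinearMap.reApplyInnerSelf_apply, h3, ← h4, inner_self_eq_ofReal]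
    rw [← Complex.ofReal_mul, RCLike.re_to_complex, Complex.sub_re, Complex.ofReal_re]
    simp only at h
    nlinarith [sq_nonneg ‖R y‖]

omit [CompleteSpace H] in
/-- A non-zero spectral value `r` of the resolvent `(A - t)⁻¹` comes from the spectral value
`t + 1 / r` of `A`. -/
theorem mem_opSpectrum_of_mem_spectrum {t r : ℂ} (hr : r ≠ 0) {R : H →L[ℂ] H}
    (hR : ∀ y : H, ∃ h : R y ∈ A.domain, A ⟨R y, h⟩ - t • R y = y)
    (hR' : ∀ x : A.domain, R (A x - t • (x : H)) = x) (h : r ∈ spectrum ℂ R) :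
    t + r⁻¹ ∈ opSpectrum A := by
  rintro ⟨Q, hQ, hQ'⟩
  choose hmem hR using hR
  choose hmemQ hQ using hQ
  have h1 : ∀ y, R (Q y) = r • (Q y - R y) := fun y => by
    have h := hR' ⟨Q y, hmemQ y⟩
    have h2 : A ⟨Q y, hmemQ y⟩ - t • Q y = y + r⁻¹ • Q y := by
      conv_rhs => enter [1]; rw [← hQ y]
      module
    rw [h2, map_add, map_smul] at h
    change _ = Q y at h
    rw [sub_eq_iff_eq_add'.2 h.symm, smul_inv_smul₀ hr]
  have h2 : ∀ y, Q (R y) = r • (Q y - R y) := fun y => by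
    have h := hQ' ⟨R y, hmem y⟩
    have h2 : A ⟨R y, hmem y⟩ - (t + r⁻¹) • R y = y - r⁻¹ • R y := by
      conv_rhs => enter [1]; rw [← hR y]
      module
    rw [h2, map_sub, map_smul] at h
    change _ = R y at h
    rw [sub_eq_iff_eq_add'.2 (sub_eq_iff_eq_add.1 h), smul_inv_smul₀ hr]
  refine h ?_
  -- the inverse of `r - R` is `r⁻¹ (1 + r⁻¹ (A - t - 1 / r)⁻¹)`
  refine ⟨⟨algebraMap ℂ (H →L[ℂ] H) r - R, r⁻¹ • (1 + r⁻¹ • Q), ?_, ?_⟩, rfl⟩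
  · ext y
    simp only [Algebra.algebraMap_eq_smul_one, mul_apply_eq_comp,
      sub_apply, smul_apply, add_apply,
      one_apply_eq_self, map_smul, map_add, h1]
    match_scalars <;> field_simp <;> ring
  · ext y
    simp only [Algebra.algebraMap_eq_smul_one, mul_apply_eq_comp,
      sub_apply, smul_apply, add_apply,
      one_apply_eq_self, map_smul, map_sub, h2]
    match_scalars <;> field_simp <;> ring

theorem exists_sqrt_of_isPositive {R : H →L[ℂ] H} (hR : R.IsPositive) :
    ∃ S : H →L[ℂ] H, IsSelfAdjoint S ∧ ∀ y, S (S y) = R y :=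
  ⟨CFC.sqrt R, (CFC.sqrt_nonneg R).isSelfAdjoint, fun y => congrArg (fun T : H →L[ℂ] H => T y)
    (CFC.sqrt_mul_sqrt_self R ((ContinuousLinearMap.nonneg_iff_isPositive R).2 hR))⟩

/-- The lowest spectral value is a lower bound of the numerical range. -/
theorem specMin_mul_le (hA : IsSelfAdjoint A) (hs : IsSemibddOp A) (x : A.domain) :
    specMin A * ‖(x : H)‖ ^ 2 ≤ (inner ℂ (A x) (x : H)).re := by
  obtain ⟨γ, hγ⟩ := hs
  rcases subsingleton_or_nontrivial H with hH | hH
  · simp [Subsingleton.elim (x : H) 0]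
  have hbdd : BddBelow (realSpectrum A) :=
    ⟨γ, fun s hs => not_lt.1 fun h => hs (mem_resolvent_of_lt hA hγ h)⟩
  obtain ⟨R, hR, hR'⟩ := mem_resolvent_of_lt hA hγ (sub_one_lt γ)
  have hpos := isPositive_of_resolvent hA hγ (sub_one_lt γ).le hR
  have hR0 : R ≠ 0 := by
    rintro rfl
    obtain ⟨y, hy⟩ := exists_ne (0 : H)
    obtain ⟨h, h1⟩ := hR y
    have h2 : (⟨(0 : H →L[ℂ] H) y, h⟩ : A.domain) = 0 := rfl
    rw [h2] at h1
    exact hy (by simpa using h1.symm)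
  have hn : 0 < ‖R‖ := norm_pos_iff.2 hR0
  have hnn : 0 ≤ R := (ContinuousLinearMap.nonneg_iff_isPositive R).2 hpos
  have hspec : ((‖R‖ : ℝ) : ℂ) ∈ spectrum ℂ R := by
    have := CStarAlgebra.norm_mem_spectrum_of_nonneg hnn
    exact spectrum.algebraMap_mem ℂ this
  have hle : specMin A ≤ (γ - 1) + ‖R‖⁻¹ := by
    refine csInf_le hbdd ?_
    have := mem_opSpectrum_of_mem_spectrum (by exact_mod_cast hn.ne') hR hR' hspec
    simpa [realSpectrum] using this
  -- with `y = (A - γ + 1) x` one has `‖x‖ ^ 2 = ‖R y‖ ^ 2 ≤ ‖R‖ ⟨y, R y⟩`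
  set y : H := A x - ((γ - 1 : ℝ) : ℂ) • (x : H) with hy
  have hyx : R y = x := hR' x
  have hsq : ‖R y‖ ^ 2 ≤ ‖R‖ * (inner ℂ y (R y)).re := by
    obtain ⟨S, hS, hSR⟩ := exists_sqrt_of_isPositive hpos
    have hSn : ‖R‖ = ‖S‖ * ‖S‖ := by
      rw [← CStarRing.norm_star_mul_self, hS.star_eq]
      exact congrArg norm (ContinuousLinearMap.ext hSR).symm
    have h1 : (inner ℂ y (R y)).re = ‖S y‖ ^ 2 := by
      rw [← hSR, ← ContinuousLinearMap.adjoint_inner_left, hS.adjoint_eq,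
        inner_self_eq_ofReal, Complex.ofReal_re]
    rw [h1, ← hSR, hSn, ← sq, ← mul_pow]
    exact pow_le_pow_left₀ (norm_nonneg _) (S.le_opNorm _) 2
  have hin : (inner ℂ y (x : H)).re = (inner ℂ (A x) (x : H)).re - (γ - 1) * ‖(x : H)‖ ^ 2 := by
    rw [hy, inner_sub_left, inner_smul_left, inner_self_eq_ofReal, Complex.conj_ofReal,
    ← Complex.ofReal_mul,
      Complex.sub_re, Complex.ofReal_re]
  rw [hyx, hin] at hsq
  have h5 : ‖R‖⁻¹ * ‖(x : H)‖ ^ 2 ≤ (inner ℂ (A x) (x : H)).re - (γ - 1) * ‖(x : H)‖ ^ 2 := by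
    rw [inv_mul_eq_div, div_le_iff₀ hn]; linarith
  nlinarith [sq_nonneg ‖(x : H)‖]

/-! ### The square root of the resolvent -/

/-- `S` is a self-adjoint square root of the resolvent `(A - c)⁻¹`. -/
structure IsResolventSqrt (A : H →ₗ.[ℂ] H) (c : ℝ) (S : H →L[ℂ] H) : Prop where
  isSelfAdjoint : IsSelfAdjoint S
  exists_mem : ∀ y : H, ∃ h : S (S y) ∈ A.domain, A ⟨S (S y), h⟩ - (c : ℂ) • S (S y) = y
  apply_sub : ∀ x : A.domain, S (S (A x - (c : ℂ) • (x : H))) = x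

theorem exists_isResolventSqrt (hA : IsSelfAdjoint A) (hs : IsSemibddOp A) :
    ∃ S : H →L[ℂ] H, IsResolventSqrt A (specMin A - 1) S := by
  obtain ⟨R, hR, hR'⟩ := mem_resolvent_of_lt hA (specMin_mul_le hA hs) (sub_one_lt _)
  obtain ⟨S, hS, hSR⟩ := exists_sqrt_of_isPositive
    (isPositive_of_resolvent hA (specMin_mul_le hA hs) (sub_one_lt _).le hR)
  obtain rfl : S ∘L S = R := ContinuousLinearMap.ext hSR
  exact ⟨S, hS, hR, hR'⟩

namespace IsResolventSqrt

variable {c : ℝ} {S : H →L[ℂ] H} (hS : IsResolventSqrt A c S)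
include hS

theorem inner_left (f g : H) : inner ℂ (S f) g = inner ℂ f (S g) := by
  rw [← ContinuousLinearMap.adjoint_inner_right, hS.isSelfAdjoint.adjoint_eq]

theorem injective : Function.Injective S := by
  have h0 : ∀ y, S y = 0 → y = 0 := fun y hy => by
    obtain ⟨h, h1⟩ := hS.exists_mem y
    have h2 : (⟨S (S y), h⟩ : A.domain) = 0 := Subtype.ext (by simp [hy])
    rw [← h1, h2, hy]
    simp
  intro y z hyz
  exact sub_eq_zero.1 (h0 _ (by rw [map_sub, hyz, sub_self]))

theorem denseRange : DenseRange S := by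
  have h : (LinearMap.range S.toLinearMap)ᗮ = ⊥ := by
    rw [Submodule.eq_bot_iff]
    intro z hz
    refine hS.injective ?_
    rw [map_zero, ← inner_self_eq_zero (𝕜 := ℂ), hS.inner_left]
    exact Submodule.inner_left_of_mem_orthogonal (LinearMap.mem_range_self S.toLinearMap (S z)) hz
  rw [← Submodule.topologicalClosure_eq_top_iff] at h
  exact (Submodule.dense_iff_topologicalClosure_eq_top).2 h

theorem inner_apply_apply (f g : H) (hf : S (S f) ∈ A.domain) :
    inner ℂ (A ⟨S (S f), hf⟩) (S (S g)) =
      inner ℂ (S f) (S g) + c * inner ℂ (S (S f)) (S (S g)) := by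
  obtain ⟨h, h1⟩ := hS.exists_mem f
  rw [sub_eq_iff_eq_add.1 h1, inner_add_left, inner_smul_left, Complex.conj_ofReal,
    hS.inner_left f (S g)]

theorem exists_formApprox (f : H) : ∃ h : ℕ → H, ∃ x : ℕ → A.domain,
    Tendsto (fun n => S (h n)) atTop (𝓝 f) ∧ (∀ n, (x n : H) = S (S (h n))) ∧
      FormApprox A x (S f) := by
  obtain ⟨w, hw, hwf⟩ := mem_closure_iff_seq_limit.1 (hS.denseRange f)
  choose h hh using hw
  have hx : ∀ n, S (S (h n)) ∈ A.domain := fun n => (hS.exists_mem (h n)).1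
  have hlim : Tendsto (fun n => S (h n)) atTop (𝓝 f) := by simpa only [hh] using hwf
  have hlim2 : Tendsto (fun n => S (S (h n))) atTop (𝓝 (S f)) := (S.continuous.tendsto f).comp hlim
  refine ⟨h, fun n => ⟨_, hx n⟩, hlim, fun n => rfl, hlim2, ?_⟩
  have hd : ∀ {v : ℕ → H} {u : H}, Tendsto v atTop (𝓝 u) →
      Tendsto (fun p : ℕ × ℕ => v p.1 - v p.2) atTop (𝓝 0) := fun {v u} hv => by
    rw [← prod_atTop_atTop_eq, ← sub_self u]
    exact (hv.comp tendsto_fst).sub (hv.comp tendsto_snd)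
  have h1 := ((hd hlim).inner (𝕜 := ℂ) (hd hlim)).add
    (((hd hlim2).inner (𝕜 := ℂ) (hd hlim2)).const_mul (c : ℂ))
  simp only [inner_zero_left, mul_zero, add_zero] at h1
  refine h1.congr fun p => ?_
  have h2 := hS.inner_apply_apply (h p.1 - h p.2) (h p.1 - h p.2) (hS.exists_mem _).1
  simp only [map_sub] at h2
  rw [← h2]
  rfl

/-- The form domain is the range of the square root of the resolvent. -/
theorem mem_formDomain_iff {u : H} : u ∈ formDomain A ↔ ∃ f, S f = u := by
  constructor
  · rintro ⟨x, hx, hx2⟩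
    -- `x n = S (f n)` with `f n = S ((A - c) x n)`, and `‖f n - f m‖ ^ 2` is the shifted form
    let h : ℕ → H := fun n => A (x n) - (c : ℂ) • (x n : H)
    have hh : ∀ n, S (S (h n)) = x n := fun n => hS.apply_sub (x n)
    have hcau : CauchySeq fun n => S (h n) := by
      rw [cauchySeq_iff_tendsto_dist_atTop_0]
      have hd : Tendsto (fun p : ℕ × ℕ => ((x p.1 - x p.2 : A.domain) : H)) atTop (𝓝 0) := by
        rw [← prod_atTop_atTop_eq, ← sub_self u]
        exact (hx.comp tendsto_fst).sub (hx.comp tendsto_snd)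
      have h1 := hx2.sub ((hd.inner (𝕜 := ℂ) hd).const_mul (c : ℂ))
      simp only [inner_zero_left, mul_zero, sub_zero] at h1
      have h2 := (Real.continuous_sqrt.tendsto _).comp ((Complex.continuous_re.tendsto _).comp h1)
      simp only [Complex.zero_re, Real.sqrt_zero] at h2
      refine h2.congr fun p => ?_
      have h3 : (x p.1 - x p.2 : A.domain) =
          ⟨S (S (h p.1 - h p.2)), (hS.exists_mem _).1⟩ := Subtype.ext (by simp [hh])
      simp only [Function.comp_apply]
      rw [h3, hS.inner_apply_apply, add_sub_cancel_right, dist_eq_norm, ← map_sub,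
        inner_self_eq_ofReal, Complex.ofReal_re]
      exact Real.sqrt_sq (norm_nonneg _)
    obtain ⟨f, hf⟩ := cauchySeq_tendsto_of_complete hcau
    refine ⟨f, tendsto_nhds_unique ((S.continuous.tendsto f).comp hf) ?_⟩
    simpa only [Function.comp_def, hh] using hx
  · rintro ⟨f, rfl⟩
    obtain ⟨h, x, -, -, hx⟩ := hS.exists_formApprox f
    exact ⟨x, hx⟩

/-- `S` carries the inner product of `H` to the shifted form. -/
theorem form_apply (hA : IsSelfAdjoint A) (hs : IsSemibddOp A) (f g : H) :
    form A (S f) (S g) = inner ℂ f g + c * inner ℂ (S f) (S g) := by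
  obtain ⟨h, x, hh, hx, hxf⟩ := hS.exists_formApprox f
  obtain ⟨k, y, hk, hy, hyg⟩ := hS.exists_formApprox g
  refine tendsto_nhds_unique (tendsto_form hA hs hxf hyg) ?_
  refine ((hh.inner (𝕜 := ℂ) hk).add ((((S.continuous.tendsto f).comp hh).inner (𝕜 := ℂ)
    ((S.continuous.tendsto g).comp hk)).const_mul (c : ℂ))).congr fun n => ?_
  have h1 : x n = ⟨S (S (h n)), (hS.exists_mem _).1⟩ := Subtype.ext (hx n)
  rw [h1, hy, hS.inner_apply_apply]
  rfl

theorem mem_eigenspace_iff {t : ℝ} {u : H} :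
    u ∈ eigenspace A (t : ℂ) ↔ ((t - c : ℝ) : ℂ) • S (S u) = u := by
  constructor
  · rintro ⟨x, hx, rfl⟩
    have h1 : A x = (t : ℂ) • (x : H) := sub_eq_zero.1 hx
    have h2 := hS.apply_sub x
    rw [h1, ← sub_smul, map_smul, map_smul] at h2
    simpa using h2
  · intro h
    obtain ⟨hm, h1⟩ := hS.exists_mem (((t - c : ℝ) : ℂ) • u)
    have h2 : S (S (((t - c : ℝ) : ℂ) • u)) = u := by rw [map_smul, map_smul, h]
    refine ⟨⟨_, hm⟩, ?_, h2⟩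
    change A ⟨_, hm⟩ - (t : ℂ) • S (S (((t - c : ℝ) : ℂ) • u)) = 0
    rw [sub_eq_iff_eq_add.1 h1, h2]
    push_cast
    module

end IsResolventSqrt

theorem IsResolventSqrt.formNorm_apply {S : H →L[ℂ] H} (hS : IsResolventSqrt A (specMin A - 1) S)
    (hA : IsSelfAdjoint A) (hs : IsSemibddOp A) (f : H) : formNorm A (S f) = ‖f‖ := by
  rw [formNorm, formInner, hS.form_apply hA hs, add_sub_cancel_right, inner_self_eq_ofReal,
    Complex.ofReal_re]
  exact Real.sqrt_sq (norm_nonneg _)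

end Operator

/-! ### Symmetric operators in finite dimension -/

section FiniteDimensional

variable {E : Type*} [NormedAddCommGroup E] [InnerProductSpace ℂ E] [FiniteDimensional ℂ E]
  {T : E →ₗ[ℂ] E}

/-- An approximate eigenvector `x` of a symmetric operator is close to a sum of eigenvectors with
nearby eigenvalues: the residual dominates the component of `x` along the other ones. -/
theorem exists_mem_iSup_eigenspace (hT : T.IsSymmetric) (ν : ℝ) {ε : ℝ} (hε : 0 ≤ ε) (x : E) :
    ∃ w ∈ ⨆ t ∈ {t : ℝ | |t - ν| < ε}, Module.End.eigenspace T (t : ℂ),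
      ε * ‖x - w‖ ≤ ‖T x - (ν : ℂ) • x‖ := by
  classical
  let e := hT.eigenvectorBasis rfl
  let l := hT.eigenvalues rfl
  have hTe : ∀ i, T (e i) = (l i : ℂ) • e i := fun i => hT.apply_eigenvectorBasis rfl i
  let F : Finset (Fin (Module.finrank ℂ E)) := {i | |l i - ν| < ε}
  have hin : ∀ i, inner ℂ (e i) (T x - (ν : ℂ) • x) = ((l i - ν : ℝ) : ℂ) * inner ℂ (e i) x := by
    intro i
    rw [inner_sub_right, ← hT (e i) x, hTe, inner_smul_left, inner_smul_right, Complex.conj_ofReal]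
    push_cast
    ring
  refine ⟨∑ i ∈ F, inner ℂ (e i) x • e i, Submodule.sum_mem _ fun i hi => ?_, ?_⟩
  · refine Submodule.smul_mem _ _ ?_
    have hi' : l i ∈ {t : ℝ | |t - ν| < ε} := (Finset.mem_filter.1 hi).2
    exact Submodule.mem_iSup_of_mem (l i)
      (Submodule.mem_iSup_of_mem hi' (Module.End.mem_eigenspace_iff.2 (hTe i)))
  · refine abs_le_of_sq_le_sq' ?_ (norm_nonneg _) |>.2
    rw [mul_pow, ← e.sum_sq_norm_inner_right (T x - (ν : ℂ) • x),
      ← e.sum_sq_norm_inner_right (x - _), Finset.mul_sum]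
    refine Finset.sum_le_sum fun i _ => ?_
    rw [hin, norm_mul, mul_pow, Complex.norm_real, Real.norm_eq_abs, inner_sub_right, inner_sum]
    simp only [inner_smul_right, e.inner_eq_ite, mul_ite, mul_one, mul_zero, Finset.sum_ite_eq]
    by_cases hi : i ∈ F
    · rw [if_pos hi, sub_self, norm_zero, zero_pow two_ne_zero, mul_zero]
      positivity
    · rw [if_neg hi, sub_zero]
      have : ε ≤ |l i - ν| := not_lt.1 fun h => hi (Finset.mem_filter.2 ⟨Finset.mem_univ _, h⟩)
      gcongr

theorem mul_norm_sq_le_of_mem_iSup_eigenspace (hT : T.IsSymmetric) {ν : ℝ} {x : E}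
    (hx : x ∈ ⨆ t ∈ {t : ℝ | ν ≤ t}, Module.End.eigenspace T (t : ℂ)) :
    ν * ‖x‖ ^ 2 ≤ (inner ℂ (T x) x).re := by
  let e := hT.eigenvectorBasis rfl
  let l := hT.eigenvalues rfl
  have hTe : ∀ i, T (e i) = (l i : ℂ) • e i := fun i => hT.apply_eigenvectorBasis rfl i
  have h0 : ∀ i, l i < ν → inner ℂ (e i) x = 0 := fun i hi => by
    have hle : ⨆ t ∈ {t : ℝ | ν ≤ t}, Module.End.eigenspace T (t : ℂ) ≤ (ℂ ∙ e i)ᗮ := by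
      refine iSup₂_le fun t ht y hy => ?_
      rw [Submodule.mem_orthogonal_singleton_iff_inner_right]
      have h1 := hT (e i) y
      rw [Module.End.mem_eigenspace_iff.1 hy, hTe, inner_smul_left, inner_smul_right,
        Complex.conj_ofReal, ← sub_eq_zero, ← sub_mul] at h1
      refine (mul_eq_zero.1 h1).resolve_left ?_
      rw [sub_eq_zero]
      exact_mod_cast (hi.trans_le ht).ne
    exact (Submodule.mem_orthogonal_singleton_iff_inner_right).1 (hle hx)
  have h1 : (inner ℂ (T x) x).re = ∑ i, l i * ‖inner ℂ (e i) x‖ ^ 2 := by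
    rw [← e.sum_inner_mul_inner (T x) x, Complex.re_sum]
    refine Finset.sum_congr rfl fun i _ => ?_
    rw [hT x (e i), hTe, inner_smul_right, ← inner_conj_symm x (e i), mul_assoc,
      Complex.conj_mul']
    norm_cast
  rw [h1, ← e.sum_sq_norm_inner_right x, Finset.mul_sum]
  refine Finset.sum_le_sum fun i _ => ?_
  rcases lt_or_ge (l i) ν with h | h
  · rw [h0 i h]; simp
  · gcongr

end FiniteDimensional

/-! ### Gaps and asymptotic containment of subspaces -/

section Gap

variable {H : Type*} [NormedAddCommGroup H] [InnerProductSpace ℂ H]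

/-- The subspaces `X n` are asymptotically contained in the `Y n`: the distance of a unit vector
of `X n` to `Y n` tends to zero, uniformly. -/
def AsympContained (X Y : ℕ → Submodule ℂ H) : Prop :=
  ∀ ε > 0, ∀ᶠ n in atTop, ∀ u ∈ X n, ∃ v ∈ Y n, ‖u - v‖ ≤ ε * ‖u‖

/-- For a fixed space of finite dimension, approximability of each vector is enough. -/
theorem asympContained_of_forall_exists_tendsto {E : Submodule ℂ H} [FiniteDimensional ℂ E]
    {Y : ℕ → Submodule ℂ H}
    (h : ∀ u ∈ E, ∃ w : ℕ → H, (∀ n, w n ∈ Y n) ∧ Tendsto w atTop (𝓝 u)) :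
    AsympContained (fun _ => E) Y := by
  intro ε hε
  let e := stdOrthonormalBasis ℂ E
  choose w hw hlim using fun i => h (e i : H) (e i).2
  have hsum : Tendsto (fun n => ∑ i, ‖(e i : H) - w i n‖) atTop (𝓝 0) := by
    have : Tendsto (fun n => ∑ i, ‖(e i : H) - w i n‖) atTop (𝓝 (∑ i, ‖(e i : H) - (e i : H)‖)) :=
      tendsto_finsetSum _ fun i _ => (tendsto_const_nhds.sub (hlim i)).norm
    simpa using this
  filter_upwards [hsum.eventually (gt_mem_nhds hε)] with n hn u hu
  refine ⟨∑ i, inner ℂ (e i) ⟨u, hu⟩ • w i n,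
    Submodule.sum_mem _ fun i _ => Submodule.smul_mem _ _ (hw i n), ?_⟩
  have h1 : u = ∑ i, inner ℂ (e i) ⟨u, hu⟩ • (e i : H) := by
    have := congrArg Subtype.val (e.sum_repr' ⟨u, hu⟩)
    simpa using this.symm
  have h2 : u - ∑ i, inner ℂ (e i) ⟨u, hu⟩ • w i n =
      ∑ i, inner ℂ (e i) ⟨u, hu⟩ • ((e i : H) - w i n) := by
    simp only [smul_sub, Finset.sum_sub_distrib]
    rw [← h1]
  rw [h2]
  calc _ ≤ ∑ i, ‖u‖ * ‖(e i : H) - w i n‖ := by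
        refine norm_sum_le_of_le _ fun i _ => ?_
        rw [norm_smul]
        refine mul_le_mul_of_nonneg_right ?_ (norm_nonneg _)
        have := norm_inner_le_norm (𝕜 := ℂ) (e i) ⟨u, hu⟩
        rwa [e.norm_eq_one, one_mul] at this
    _ ≤ ε * ‖u‖ := by
        rw [← Finset.mul_sum, mul_comm]
        gcongr

theorem semiGap_nonneg {N : H → ℝ} (hN : ∀ u, 0 ≤ N u) (L M : Submodule ℂ H) :
    0 ≤ semiGap N L M := by
  refine Real.sSup_nonneg ?_
  rintro r ⟨u, -, -, rfl⟩
  exact Real.iInf_nonneg fun v => hN _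

theorem semiGap_le {N : H → ℝ} (hN : ∀ u, 0 ≤ N u) {L M : Submodule ℂ H} {ε : ℝ} (hε : 0 ≤ ε)
    (h : ∀ u ∈ L, N u = 1 → ∃ v ∈ M, N (u - v) ≤ ε) : semiGap N L M ≤ ε := by
  refine Real.sSup_le ?_ hε
  rintro r ⟨u, hu, hu1, rfl⟩
  obtain ⟨v, hv, hle⟩ := h u hu hu1
  exact (ciInf_le ⟨0, by rintro _ ⟨w, rfl⟩; exact hN _⟩ (⟨v, hv⟩ : M)).trans hle

theorem tendsto_semiGap {N : H → ℝ} (hN : ∀ u, 0 ≤ N u) {X Y : ℕ → Submodule ℂ H}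
    (h : ∀ ε > 0, ∀ᶠ n in atTop, ∀ u ∈ X n, N u = 1 → ∃ v ∈ Y n, N (u - v) ≤ ε) :
    Tendsto (fun n => semiGap N (X n) (Y n)) atTop (𝓝 0) := by
  rw [Metric.tendsto_atTop']
  intro ε hε
  obtain ⟨n₀, hn₀⟩ := eventually_atTop.1 (h (ε / 2) (half_pos hε))
  refine ⟨n₀, fun n hn => ?_⟩
  rw [Real.dist_eq, sub_zero, abs_of_nonneg (semiGap_nonneg hN _ _)]
  exact (semiGap_le hN (half_pos hε).le (hn₀ n hn.le)).trans_lt (half_lt_self hε)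

theorem AsympContained.tendsto_semiGap {X Y : ℕ → Submodule ℂ H} (h : AsympContained X Y) :
    Tendsto (fun n => semiGap (fun u : H => ‖u‖) (X n) (Y n)) atTop (𝓝 0) :=
  Galerkin.tendsto_semiGap norm_nonneg fun ε hε => (h ε hε).mono fun n hn u hu hu1 => by
    simpa [hu1] using hn u hu

theorem asympContained_of_tendsto_semiGap {X Y : ℕ → Submodule ℂ H}
    (h : Tendsto (fun n => semiGap (fun u : H => ‖u‖) (X n) (Y n)) atTop (𝓝 0)) :
    AsympContained X Y := by
  intro ε hε
  filter_upwards [h.eventually (gt_mem_nhds hε)] with n hn u hu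
  rcases eq_or_ne u 0 with rfl | hu0
  · exact ⟨0, zero_mem _, by simp⟩
  have hu1 : ‖((‖u‖⁻¹ : ℝ) : ℂ) • u‖ = 1 := by
    rw [norm_smul, Complex.norm_real, norm_inv, norm_norm, inv_mul_cancel₀ (norm_ne_zero_iff.2 hu0)]
  have hbdd : ∀ w : H, BddBelow (Set.range fun v : Y n => ‖w - v‖) := fun w =>
    ⟨0, by rintro _ ⟨v, rfl⟩; exact norm_nonneg _⟩
  have hle : ⨅ v : Y n, ‖((‖u‖⁻¹ : ℝ) : ℂ) • u - v‖ ≤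
      semiGap (fun u : H => ‖u‖) (X n) (Y n) := by
    refine le_csSup ⟨1, ?_⟩ ⟨_, Submodule.smul_mem _ _ hu, hu1, rfl⟩
    rintro _ ⟨w, -, hw1, rfl⟩
    exact (ciInf_le (hbdd w) 0).trans (by simp [hw1])
  obtain ⟨v, hv⟩ := exists_lt_of_ciInf_lt (hle.trans_lt hn)
  refine ⟨((‖u‖ : ℝ) : ℂ) • (v : H), Submodule.smul_mem _ _ v.2, ?_⟩
  have h1 : u - ((‖u‖ : ℝ) : ℂ) • (v : H) =
      ((‖u‖ : ℝ) : ℂ) • (((‖u‖⁻¹ : ℝ) : ℂ) • u - (v : H)) := by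
    rw [smul_sub, smul_smul, ← Complex.ofReal_mul, mul_inv_cancel₀ (norm_ne_zero_iff.2 hu0),
      Complex.ofReal_one, one_smul]
  rw [h1, norm_smul, Complex.norm_real, norm_norm, mul_comm]
  gcongr

end Gap

variable {H : Type*} [NormedAddCommGroup H] [InnerProductSpace ℂ H]

/-! ### Galerkin eigenvectors as eigenvectors of a compression -/

section Compression

/-- The compression to `M` of the square of the operator `S`. -/
noncomputable def compression (S : H →L[ℂ] H) (M : Submodule ℂ H) [M.HasOrthogonalProjection] :
    M →ₗ[ℂ] M :=
  (M.orthogonalProjectionOnto ∘L S ∘L S ∘L M.subtypeL).toLinearMap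

theorem compression_apply (S : H →L[ℂ] H) (M : Submodule ℂ H) [M.HasOrthogonalProjection] (f : M) :
    compression S M f = M.orthogonalProjectionOnto (S (S f)) := rfl

variable [CompleteSpace H] {A : H →ₗ.[ℂ] H} {c : ℝ} {S : H →L[ℂ] H}

namespace IsResolventSqrt

variable (hS : IsResolventSqrt A c S)
include hS

theorem inner_compression (M : Submodule ℂ H) [M.HasOrthogonalProjection] (f g : M) :
    inner ℂ (compression S M f) g = inner ℂ (S f) (S g) := by
  rw [compression_apply, Submodule.inner_orthogonalProjectionOnto_eq_of_mem_right, hS.inner_left]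

theorem isSymmetric_compression (M : Submodule ℂ H) [M.HasOrthogonalProjection] :
    (compression S M).IsSymmetric := fun f g => by
  rw [hS.inner_compression, ← inner_conj_symm f, hS.inner_compression, inner_conj_symm]

theorem compression_apply_eq_iff {M : Submodule ℂ H} [M.HasOrthogonalProjection] {f : M} {ν : ℝ} :
    compression S M f = (ν : ℂ) • f ↔
      ∀ g ∈ M, inner ℂ (S f) (S g) = ν * inner ℂ (f : H) g := by
  rw [ext_iff_inner_right ℂ]
  refine Subtype.forall.trans (forall₂_congr fun g hg => ?_)
  rw [hS.inner_compression, inner_smul_left, Complex.conj_ofReal, Submodule.coe_inner]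

theorem norm_pos {f : H} (hf : f ≠ 0) : 0 < ‖S f‖ :=
  norm_pos_iff.2 fun h => hf (hS.injective (by rw [h, map_zero]))

theorem mul_norm_sq_of_compression_apply_eq {M : Submodule ℂ H} [M.HasOrthogonalProjection] {f : M}
    {ν : ℝ} (h : compression S M f = (ν : ℂ) • f) : ν * ‖(f : H)‖ ^ 2 = ‖S f‖ ^ 2 := by
  have h1 := hS.compression_apply_eq_iff.1 h f f.2
  rw [inner_self_eq_ofReal, inner_self_eq_ofReal] at h1
  exact_mod_cast h1.symm

variable (hA : IsSelfAdjoint A) (hs : IsSemibddOp A)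
include hA hs

theorem isGalerkinSol_iff {L : Submodule ℂ H} (hL : ∀ u ∈ L, u ∈ formDomain A) {μ : ℝ} {f : H} :
    IsGalerkinSol A L μ (S f) ↔ f ∈ L.comap S.toLinearMap ∧
      ∀ g ∈ L.comap S.toLinearMap, inner ℂ f g = (μ - c : ℝ) * inner ℂ (S f) (S g) := by
  refine and_congr Iff.rfl ⟨fun h g hg => ?_, fun h v hv => ?_⟩
  · have h1 := h (S g) hg
    rw [hS.form_apply hA hs] at h1
    rw [eq_sub_of_add_eq h1]
    push_cast
    ring
  · obtain ⟨g, rfl⟩ := hS.mem_formDomain_iff.1 (hL v hv)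
    rw [hS.form_apply hA hs, h g hv]
    push_cast
    ring

theorem pos_of_isGalerkinSol {L : Submodule ℂ H} (hL : ∀ u ∈ L, u ∈ formDomain A) {μ : ℝ} {f : H}
    (hf : f ≠ 0) (h : IsGalerkinSol A L μ (S f)) : 0 < μ - c := by
  obtain ⟨hfL, h1⟩ := (hS.isGalerkinSol_iff hA hs hL).1 h
  have h2 := h1 f hfL
  rw [inner_self_eq_ofReal, inner_self_eq_ofReal] at h2
  have h3 : ‖f‖ ^ 2 = (μ - c) * ‖S f‖ ^ 2 := by exact_mod_cast h2
  have h4 : 0 < (μ - c) * ‖S f‖ ^ 2 := h3 ▸ pow_pos (norm_pos_iff.2 hf) 2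
  exact pos_of_mul_pos_left h4 (sq_nonneg _)

/-- Galerkin eigenvectors for `μ` correspond to eigenvectors for `1 / (μ - c)` of the compressed
resolvent. -/
theorem isGalerkinSol_iff_compression {L : Submodule ℂ H} (hL : ∀ u ∈ L, u ∈ formDomain A)
    [(L.comap S.toLinearMap).HasOrthogonalProjection] {μ : ℝ} (hμ : μ - c ≠ 0)
    (f : L.comap S.toLinearMap) :
    IsGalerkinSol A L μ (S f) ↔
      compression S (L.comap S.toLinearMap) f = (((μ - c)⁻¹ : ℝ) : ℂ) • f := by
  rw [hS.isGalerkinSol_iff hA hs hL, hS.compression_apply_eq_iff, and_iff_right f.2]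
  refine forall₂_congr fun g hg => ?_
  rw [Complex.ofReal_inv, eq_inv_mul_iff_mul_eq₀ (by exact_mod_cast hμ), eq_comm]

theorem mem_galerkinSubspace_of_mem_eigenspace {L : Submodule ℂ H}
    (hL : ∀ u ∈ L, u ∈ formDomain A) [(L.comap S.toLinearMap).HasOrthogonalProjection]
    {Δ : Set ℝ} {ν : ℝ} (hν : c + ν⁻¹ ∈ Δ) {f : L.comap S.toLinearMap}
    (hf : compression S (L.comap S.toLinearMap) f = (ν : ℂ) • f) :
    S f ∈ galerkinSubspace A L Δ := by
  rcases eq_or_ne (f : H) 0 with h0 | h0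
  · rw [h0, map_zero]
    exact zero_mem _
  have h1 := hS.mul_norm_sq_of_compression_apply_eq hf
  have h2 := hS.norm_pos h0
  have hν0 : ν ≠ 0 := by
    rintro rfl
    rw [zero_mul] at h1
    exact (pow_pos h2 2).ne h1
  have h3 : c + ν⁻¹ - c = ν⁻¹ := add_sub_cancel_left _ _
  have h4 : IsGalerkinSol A L (c + ν⁻¹) (S f) := by
    rw [hS.isGalerkinSol_iff_compression hA hs hL (by rw [h3]; exact inv_ne_zero hν0), h3, inv_inv,
      hf]
  exact Submodule.subset_span ⟨_, ⟨⟨_, norm_pos_iff.1 h2, h4⟩, hν⟩, h4⟩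

/-- On a Galerkin eigenspace belonging to eigenvalues in a bounded set, the form norm is controlled
by the norm of `H`. -/
theorem norm_sq_le_of_mem_galerkinSubspace {L : Submodule ℂ H}
    (hL : ∀ u ∈ L, u ∈ formDomain A) [FiniteDimensional ℂ (L.comap S.toLinearMap)]
    {Δ : Set ℝ} {B : ℝ} (hB : 0 < B) (hΔ : ∀ μ ∈ Δ, μ - c ≤ B) {f : H}
    (hf : S f ∈ galerkinSubspace A L Δ) :
    f ∈ L.comap S.toLinearMap ∧ ‖f‖ ^ 2 ≤ B * ‖S f‖ ^ 2 := by
  set M := L.comap S.toLinearMap with hM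
  have hle : galerkinSubspace A L Δ ≤
      (⨆ t ∈ {t : ℝ | B⁻¹ ≤ t}, Module.End.eigenspace (compression S M) (t : ℂ)).map
        (S.toLinearMap ∘ₗ M.subtype) := by
    refine Submodule.span_le.2 ?_
    rintro u ⟨μ, ⟨-, hμ⟩, hu⟩
    obtain ⟨f, rfl⟩ := hS.mem_formDomain_iff.1 (hL u hu.1)
    rcases eq_or_ne f 0 with rfl | h0
    · rw [map_zero]
      exact zero_mem _
    have hpos := hS.pos_of_isGalerkinSol hA hs hL h0 hu
    refine ⟨⟨f, hu.1⟩, ?_, rfl⟩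
    have h1 : (μ - c)⁻¹ ∈ {t : ℝ | B⁻¹ ≤ t} := inv_anti₀ hpos (hΔ μ hμ)
    exact Submodule.mem_iSup_of_mem _ (Submodule.mem_iSup_of_mem h1 (Module.End.mem_eigenspace_iff.2
      ((hS.isGalerkinSol_iff_compression hA hs hL hpos.ne' ⟨f, hu.1⟩).1 hu)))
  obtain ⟨x, hx, hxf⟩ := hle hf
  obtain rfl : (x : H) = f := hS.injective hxf
  refine ⟨x.2, ?_⟩
  have h1 := mul_norm_sq_le_of_mem_iSup_eigenspace (hS.isSymmetric_compression M) hx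
  rw [hS.inner_compression, inner_self_eq_ofReal, inv_mul_le_iff₀ hB] at h1
  exact_mod_cast h1

end IsResolventSqrt

end Compression

/-! ### Approximation of eigenvectors -/

section Approximation

variable [CompleteSpace H] {A : H →ₗ.[ℂ] H} {c : ℝ} {S : H →L[ℂ] H}

omit [CompleteSpace H] in
theorem tendsto_starProjection {M : ℕ → Submodule ℂ H} [∀ n, (M n).HasOrthogonalProjection] {u : H}
    {w : ℕ → H} (hw : ∀ n, w n ∈ M n) (hlim : Tendsto w atTop (𝓝 u)) :
    Tendsto (fun n => (M n).starProjection u) atTop (𝓝 u) := by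
  rw [tendsto_iff_norm_sub_tendsto_zero] at hlim ⊢
  refine squeeze_zero (fun _ => norm_nonneg _) (fun n => ?_) hlim
  rw [norm_sub_rev, norm_sub_rev (w n), Submodule.starProjection_minimal]
  exact ciInf_le ⟨0, by rintro _ ⟨v, rfl⟩; exact norm_nonneg _⟩ (⟨w n, hw n⟩ : M n)

theorem IsResolventSqrt.pos_of_mem_eigenspace (hS : IsResolventSqrt A c S) {t : ℝ} {u : H}
    (hu : u ∈ eigenspace A (t : ℂ)) (hu0 : u ≠ 0) : 0 < t - c := by
  have h1 := hS.mem_eigenspace_iff.1 hu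
  have h2 : inner ℂ (((t - c : ℝ) : ℂ) • S (S u)) u = inner ℂ u u := by rw [h1]
  rw [inner_smul_left, Complex.conj_ofReal, hS.inner_left, inner_self_eq_ofReal,
    inner_self_eq_ofReal] at h2
  have h3 : (t - c) * ‖S u‖ ^ 2 = ‖u‖ ^ 2 := by exact_mod_cast h2
  exact pos_of_mul_pos_left (h3 ▸ pow_pos (norm_pos_iff.2 hu0) 2) (sq_nonneg _)

/-- Every eigenvector of `A` is a limit, in the form norm, of sums of Galerkin eigenvectors with
eigenvalues near its own. -/
theorem IsResolventSqrt.exists_tendsto_of_mem_eigenspace (hS : IsResolventSqrt A c S)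
    (hA : IsSelfAdjoint A) (hs : IsSemibddOp A) {L : ℕ → Submodule ℂ H}
    (hL : ∀ n, ∀ u ∈ L n, u ∈ formDomain A)
    [∀ n, FiniteDimensional ℂ ((L n).comap S.toLinearMap)]
    (hdense : ∀ f, ∃ w : ℕ → H, (∀ n, w n ∈ (L n).comap S.toLinearMap) ∧ Tendsto w atTop (𝓝 f))
    {t : ℝ} {Δ : Set ℝ} (hΔ : Δ ∈ 𝓝 t) {u : H} (hu : u ∈ eigenspace A (t : ℂ)) :
    ∃ w : ℕ → H, (∀ n, w n ∈ (galerkinSubspace A (L n) Δ).comap S.toLinearMap) ∧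
      Tendsto w atTop (𝓝 u) := by
  rcases eq_or_ne u 0 with rfl | hu0
  · exact ⟨fun _ => 0, fun n => zero_mem _, tendsto_const_nhds⟩
  have hκ := hS.pos_of_mem_eigenspace hu hu0
  set ν := (t - c)⁻¹ with hν
  have hSu : S (S u) = (ν : ℂ) • u := by
    have h1 := hS.mem_eigenspace_iff.1 hu
    rw [hν, Complex.ofReal_inv, eq_inv_smul_iff₀ (by exact_mod_cast hκ.ne'), h1]
  obtain ⟨ε, hε, hεΔ⟩ : ∃ ε > 0, ∀ s : ℝ, |s - ν| < ε → c + s⁻¹ ∈ Δ := by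
    have h1 : ContinuousAt (fun s : ℝ => c + s⁻¹) ν :=
      continuousAt_const.add (continuousAt_inv₀ (inv_ne_zero hκ.ne'))
    have h2 : c + ν⁻¹ = t := by rw [hν, inv_inv, add_sub_cancel]
    exact Metric.eventually_nhds_iff.1 (h1.eventually_mem (by rwa [h2]))
  let M : ℕ → Submodule ℂ H := fun n => (L n).comap S.toLinearMap
  let x : ∀ n, M n := fun n => (M n).orthogonalProjectionOnto u
  obtain ⟨w₀, hw₀, hlim₀⟩ := hdense u
  have hx : Tendsto (fun n => (x n : H)) atTop (𝓝 u) := tendsto_starProjection (M := M) hw₀ hlim₀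
  choose w hw hwle using fun n =>
    exists_mem_iSup_eigenspace (hS.isSymmetric_compression (M n)) ν hε.le (x n)
  refine ⟨fun n => w n, fun n => ?_, ?_⟩
  · have hle : ⨆ t ∈ {t : ℝ | |t - ν| < ε}, Module.End.eigenspace (compression S (M n)) (t : ℂ) ≤
        (galerkinSubspace A (L n) Δ).comap (S.toLinearMap ∘ₗ (M n).subtype) :=
      iSup₂_le fun t ht f hf => hS.mem_galerkinSubspace_of_mem_eigenspace hA hs (hL n) (hεΔ t ht)
        (Module.End.mem_eigenspace_iff.1 hf)
    exact hle (hw n)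
  · -- the residual of `x n` is the projection of `S (S (x n - u))`
    have hres : ∀ n, ‖compression S (M n) (x n) - (ν : ℂ) • x n‖ ≤ ‖S (S ((x n : H) - u))‖ := by
      intro n
      have h1 : compression S (M n) (x n) - (ν : ℂ) • x n =
          (M n).orthogonalProjectionOnto (S (S ((x n : H) - u))) := by
        rw [compression_apply, map_sub, map_sub, hSu, map_sub, map_smul]
      rw [h1]
      exact (M n).norm_orthogonalProjectionOnto_apply_le _
    have h2 : Tendsto (fun n => ε⁻¹ * ‖S (S ((x n : H) - u))‖) atTop (𝓝 0) := by
      have h3 : Continuous fun y => ε⁻¹ * ‖S (S (y - u))‖ := by fun_prop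
      simpa only [Function.comp_def, sub_self, map_zero, norm_zero, mul_zero] using
        (h3.tendsto u).comp hx
    have h4 : Tendsto (fun n => (x n : H) - w n) atTop (𝓝 0) := by
      refine squeeze_zero_norm (fun n => ?_) h2
      rw [le_inv_mul_iff₀ hε]
      exact (hwle n).trans (hres n)
    simpa using hx.sub h4

/-- The limits of sequences `w n ∈ Y n`, as a subspace. -/
def limitSubspace (Y : ℕ → Submodule ℂ H) : Submodule ℂ H where
  carrier := {u | ∃ w : ℕ → H, (∀ n, w n ∈ Y n) ∧ Tendsto w atTop (𝓝 u)}
  add_mem' := by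
    rintro u v ⟨w, hw, hwu⟩ ⟨z, hz, hzv⟩
    exact ⟨fun n => w n + z n, fun n => add_mem (hw n) (hz n), hwu.add hzv⟩
  zero_mem' := ⟨fun _ => 0, fun n => zero_mem _, tendsto_const_nhds⟩
  smul_mem' := by
    rintro k u ⟨w, hw, hwu⟩
    exact ⟨fun n => k • w n, fun n => Submodule.smul_mem _ _ (hw n), hwu.const_smul k⟩

end Approximation

/-! ### The spectrum in an interval free of essential spectrum -/

section DiscreteSpectrum

variable {A : H →ₗ.[ℂ] H} {a b : ℝ}

theorem mem_discreteSpectrum (hess : ∀ t ∈ Set.Icc a b, (t : ℂ) ∉ essSpectrum A) {t : ℝ}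
    (ht : t ∈ realSpectrum A ∩ Set.Icc a b) : (t : ℂ) ∈ discreteSpectrum A :=
  not_not.1 fun h => hess t ht.2 ⟨ht.1, h⟩

/-- Without essential spectrum in the compact interval, the spectrum has no accumulation point
there: such a point would be an isolated spectral value, or a limit of eigenvalues `s` in the
resolvent set, where `1 ≤ |s - t| * ‖(A - t)⁻¹‖`. -/
theorem finite_realSpectrum_inter (hess : ∀ t ∈ Set.Icc a b, (t : ℂ) ∉ essSpectrum A) :
    (realSpectrum A ∩ Set.Icc a b).Finite := by
  by_contra hinf
  obtain ⟨x, hx, hacc⟩ := Set.Infinite.exists_accPt_of_subset_isCompact hinf isCompact_Icc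
    Set.inter_subset_right
  rw [accPt_iff_nhds] at hacc
  by_cases hxs : x ∈ realSpectrum A
  · obtain ⟨-, ⟨ε, hε, h⟩, -⟩ := mem_discreteSpectrum hess ⟨hxs, hx⟩
    obtain ⟨y, ⟨hyx, hy⟩, hne⟩ := hacc _ (Metric.ball_mem_nhds x hε)
    refine hne (Complex.ofReal_injective (h y hy.1 ?_))
    rwa [← Complex.ofReal_sub, Complex.norm_real, ← dist_eq_norm]
  · obtain ⟨Q, -, hQ⟩ : (x : ℂ) ∈ resolvent A := not_not.1 hxs
    obtain ⟨y, ⟨hyx, hy⟩, -⟩ := hacc _ (Metric.ball_mem_nhds x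
      (show 0 < (‖Q‖ + 1)⁻¹ by positivity))
    obtain ⟨-, -, hne, -⟩ := mem_discreteSpectrum hess hy
    obtain ⟨u, hu, hu0⟩ := Submodule.exists_mem_ne_zero_of_ne_bot hne
    obtain ⟨v, hv, rfl⟩ := hu
    have h1 : A v = (y : ℂ) • (v : H) := sub_eq_zero.1 hv
    have h2 := hQ v
    rw [h1, ← sub_smul, map_smul] at h2
    have h3 : ‖(v : H)‖ ≤ |y - x| * (‖Q‖ * ‖(v : H)‖) := by
      conv_lhs => rw [← h2]
      rw [norm_smul, ← Complex.ofReal_sub, Complex.norm_real, Real.norm_eq_abs]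
      gcongr
      exact Q.le_opNorm _
    have hvpos : 0 < ‖(v : H)‖ := norm_pos_iff.2 hu0
    rw [Metric.mem_ball, Real.dist_eq, ← one_div, lt_div_iff₀ (by positivity)] at hyx
    nlinarith [abs_nonneg (y - x), norm_nonneg Q]

theorem finiteDimensional_spectralSubspace
    (hess : ∀ t ∈ Set.Icc a b, (t : ℂ) ∉ essSpectrum A) :
    FiniteDimensional ℂ (spectralSubspace A (Set.Icc a b)) := by
  have hfin := (finite_realSpectrum_inter hess).to_subtype
  have h1 : ∀ t : ↥(realSpectrum A ∩ Set.Icc a b),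
      FiniteDimensional ℂ (eigenspace A ((t : ℝ) : ℂ)) :=
    fun t => (mem_discreteSpectrum hess t.2).2.2.2
  rw [spectralSubspace, iSup_subtype']
  exact Submodule.finiteDimensional_iSup _

end DiscreteSpectrum

section Convergence

/-! ### Hausdorff convergence -/

theorem tendsto_hausdorffEDist_zero {s : ℕ → Set ℝ} {t : Set ℝ} (ht : t.Finite)
    (h1 : ∀ η > 0, ∀ᶠ n in atTop, ∀ x ∈ s n, ∃ y ∈ t, |x - y| ≤ η)
    (h2 : ∀ η > 0, ∀ y ∈ t, ∀ᶠ n in atTop, ∃ x ∈ s n, |x - y| ≤ η) :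
    Tendsto (fun n => Metric.hausdorffEDist (s n) t) atTop (𝓝 0) := by
  rw [ENNReal.tendsto_nhds_zero]
  intro ε hε
  obtain ⟨η, hη, hηε⟩ := ENNReal.lt_iff_exists_nnreal_btwn.1 hε
  have hη' : 0 < (η : ℝ) := by exact_mod_cast hη
  have he : ∀ x y : ℝ, |x - y| ≤ η → edist x y ≤ ε := fun x y h =>
    (show edist x y ≤ η by rw [edist_nndist]; exact_mod_cast h).trans hηε.le
  filter_upwards [h1 η hη', (ht.eventually_all).2 (h2 η hη')] with n hn1 hn2
  refine Metric.hausdorffEDist_le_of_mem_edist (fun x hx => ?_) fun y hy => ?_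
  · obtain ⟨y, hy, h⟩ := hn1 x hx
    exact ⟨y, hy, he x y h⟩
  · obtain ⟨x, hx, h⟩ := hn2 y hy
    exact ⟨x, hx, by rw [edist_comm]; exact he x y h⟩

theorem galerkinSpectrum_inter_nonempty {A : H →ₗ.[ℂ] H} {L : Submodule ℂ H} {Δ : Set ℝ} {u : H}
    (hu : u ∈ galerkinSubspace A L Δ) (hu0 : u ≠ 0) : (galerkinSpectrum A L ∩ Δ).Nonempty := by
  by_contra h
  rw [Set.not_nonempty_iff_eq_empty] at h
  have : galerkinSubspace A L Δ = ⊥ := by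
    rw [galerkinSubspace, h]
    simp
  rw [this] at hu
  exact hu0 hu

theorem IsBddOp.isSemibddOp {A : H →ₗ.[ℂ] H} (hA : IsBddOp A) : IsSemibddOp A := by
  obtain ⟨C, hC⟩ := hA
  refine ⟨-C, fun x => ?_⟩
  have h1 := (Complex.abs_re_le_norm _).trans (norm_inner_le_norm (𝕜 := ℂ) (A x) (x : H))
  nlinarith [neg_abs_le (inner ℂ (A x) (x : H)).re, hC x, norm_nonneg (x : H)]

variable [CompleteSpace H] {A : H →ₗ.[ℂ] H} {c : ℝ} {S : H →L[ℂ] H}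

/-! ### The spectral subspace and its approximation -/

namespace IsResolventSqrt

variable (hS : IsResolventSqrt A c S)
include hS

theorem finiteDimensional_comap {L : Submodule ℂ H} [FiniteDimensional ℂ L] :
    FiniteDimensional ℂ (L.comap S.toLinearMap) :=
  FiniteDimensional.of_injective (S.toLinearMap.restrict (q := L) fun _ h => h) fun _ _ h =>
    Subtype.ext (hS.injective (congrArg Subtype.val h))

theorem apply_mem_eigenspace {t : ℝ} {u : H} (hu : u ∈ eigenspace A (t : ℂ)) :
    S u ∈ eigenspace A (t : ℂ) := by
  rw [hS.mem_eigenspace_iff] at hu ⊢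
  conv_rhs => rw [← hu]
  rw [map_smul]

theorem apply_mem_spectralSubspace {Δ : Set ℝ} {u : H} (hu : u ∈ spectralSubspace A Δ) :
    S u ∈ spectralSubspace A Δ := by
  have hle : spectralSubspace A Δ ≤ (spectralSubspace A Δ).comap S.toLinearMap :=
    iSup₂_le fun t ht v hv =>
      Submodule.mem_iSup_of_mem t (Submodule.mem_iSup_of_mem ht (hS.apply_mem_eigenspace hv))
  exact hle hu

theorem exists_apply_eq_of_mem_spectralSubspace {Δ : Set ℝ} {u : H}
    (hu : u ∈ spectralSubspace A Δ) : ∃ f ∈ spectralSubspace A Δ, S f = u := by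
  have hle : spectralSubspace A Δ ≤ (spectralSubspace A Δ).map S.toLinearMap :=
    iSup₂_le fun t ht v hv => by
      refine ⟨((t - c : ℝ) : ℂ) • S v, Submodule.smul_mem _ _ (Submodule.mem_iSup_of_mem t
        (Submodule.mem_iSup_of_mem ht (hS.apply_mem_eigenspace hv))), ?_⟩
      have := hS.mem_eigenspace_iff.1 hv
      simpa using this
  exact hle hu

theorem comap_spectralSubspace (Δ : Set ℝ) :
    (spectralSubspace A Δ).comap S.toLinearMap = spectralSubspace A Δ := by
  refine le_antisymm (fun f hf => ?_) fun f hf => hS.apply_mem_spectralSubspace hf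
  obtain ⟨g, hg, h⟩ := hS.exists_apply_eq_of_mem_spectralSubspace hf
  rwa [← hS.injective h]

theorem inner_eq_zero_of_mem_eigenspace {s t : ℝ} (hst : s ≠ t) {u v : H}
    (hu : u ∈ eigenspace A (s : ℂ)) (hv : v ∈ eigenspace A (t : ℂ)) : inner ℂ u v = 0 := by
  rw [hS.mem_eigenspace_iff] at hu hv
  have h1 : inner ℂ u v = ((s - c : ℝ) : ℂ) * inner ℂ (S u) (S v) := by
    conv_lhs => rw [← hu, inner_smul_left, Complex.conj_ofReal, hS.inner_left]
  have h2 : inner ℂ u v = ((t - c : ℝ) : ℂ) * inner ℂ (S u) (S v) := by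
    conv_lhs => rw [← hv, inner_smul_right, ← hS.inner_left]
  rw [h2, ← sub_eq_zero, ← sub_mul, ← Complex.ofReal_sub, sub_sub_sub_cancel_right] at h1
  rw [h2, (mul_eq_zero.1 h1).resolve_left (by exact_mod_cast (sub_ne_zero.2 hst.symm)), mul_zero]

/-- The subspace `L(Δ)` contains no eigenvectors with eigenvalues outside `σ(A) ∩ Δ`. -/
theorem mem_of_mem_eigenspace_of_mem_spectralSubspace {Δ : Set ℝ} {t : ℝ} {u : H}
    (hu : u ∈ eigenspace A (t : ℂ)) (hu' : u ∈ spectralSubspace A Δ) (hu0 : u ≠ 0) :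
    t ∈ realSpectrum A ∩ Δ := by
  by_contra ht
  have hle : spectralSubspace A Δ ≤ (ℂ ∙ u)ᗮ := iSup₂_le fun s hs v hv =>
    Submodule.mem_orthogonal_singleton_iff_inner_right.2
      (hS.inner_eq_zero_of_mem_eigenspace (by rintro rfl; exact ht hs) hu hv)
  exact hu0 (inner_self_eq_zero.1 (Submodule.mem_orthogonal_singleton_iff_inner_right.1 (hle hu')))

theorem tendsto_semiGap_formNorm (hN : ∀ f, formNorm A (S f) = ‖f‖) {X Y : ℕ → Submodule ℂ H}
    (hX : ∀ n, ∀ u ∈ X n, u ∈ formDomain A)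
    (h : AsympContained (fun n => (X n).comap S.toLinearMap) fun n => (Y n).comap S.toLinearMap) :
    Tendsto (fun n => semiGap (formNorm A) (X n) (Y n)) atTop (𝓝 0) := by
  refine tendsto_semiGap (N := formNorm A) (fun u => Real.sqrt_nonneg _) fun ε hε =>
    (h ε hε).mono fun n hn u hu hu1 => ?_
  obtain ⟨f, rfl⟩ := hS.mem_formDomain_iff.1 (hX n u hu)
  obtain ⟨g, hg, hle⟩ := hn f hu
  rw [hN] at hu1
  exact ⟨S g, hg, by rw [← map_sub, hN]; simpa [hu1] using hle⟩

/-- On a finite-dimensional space the form norm is controlled by the norm of `H`. -/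
theorem exists_norm_le (E : Submodule ℂ H) [FiniteDimensional ℂ E] :
    ∃ K : ℝ, 0 < K ∧ ∀ g ∈ E, ‖g‖ ≤ K * ‖S g‖ := by
  obtain ⟨K, hK, h⟩ := (S.toLinearMap ∘ₗ E.subtype).exists_antilipschitzWith
    (LinearMap.ker_eq_bot.2 (hS.injective.comp Subtype.val_injective))
  refine ⟨K, by exact_mod_cast hK, fun g hg => ?_⟩
  simpa using h.le_mul_dist ⟨g, hg⟩ 0

/-- Asymptotic containment in the norm of `H` improves to the form norm, for spaces on which the
form norm is controlled by that of `H`, provided that the converse containment holds in the form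
norm. -/
theorem asympContained_comap {X : ℕ → Submodule ℂ H} {E : Submodule ℂ H}
    [FiniteDimensional ℂ E] (hE : ∀ u ∈ E, ∃ f ∈ E, S f = u)
    {B : ℝ} (hB : ∀ n, ∀ f, S f ∈ X n → ‖f‖ ≤ B * ‖S f‖)
    (hB0 : 0 ≤ B) (hXE : AsympContained X fun _ => E)
    (hEX : AsympContained (fun _ => E) fun n => (X n).comap S.toLinearMap) :
    AsympContained (fun n => (X n).comap S.toLinearMap) fun _ => E := by
  obtain ⟨K, hK, hKE⟩ := hS.exists_norm_le E
  set s := ‖S‖ with hs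
  have hs0 : 0 ≤ s := norm_nonneg _
  intro ε hε
  set C := B * s + B * s * (2 * K * s) + 2 * K * s with hC
  have hC0 : 0 ≤ C := by positivity
  obtain ⟨δ, hδ, hδ1, hδC⟩ : ∃ δ > 0, δ ≤ 1 ∧ δ * C ≤ ε := by
    refine ⟨min 1 (ε / (C + 1)), by positivity, min_le_left _ _, ?_⟩
    calc _ ≤ ε / (C + 1) * (C + 1) := by
          gcongr
          · exact min_le_right _ _
          · linarith
      _ = ε := by field_simp
  filter_upwards [hXE δ hδ, hEX δ hδ] with n h1 h2 f hf
  -- `S g` is close to `S f`, and `w` is close to `g` in the form norm; since `f - w` lies in a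
  -- space where the two norms are comparable, so is `g` to `f`
  obtain ⟨v, hv, hfv⟩ := h1 (S f) hf
  obtain ⟨g, hg, rfl⟩ := hE v hv
  obtain ⟨w, hw, hgw⟩ := h2 g hg
  refine ⟨g, hg, ?_⟩
  have e1 : ‖S f‖ ≤ s * ‖f‖ := S.le_opNorm f
  have e2 : ‖S f - S g‖ ≤ δ * (s * ‖f‖) := hfv.trans (by gcongr)
  have e3 : ‖g‖ ≤ 2 * K * s * ‖f‖ := by
    have : ‖S g‖ ≤ ‖S f‖ + ‖S f - S g‖ := by
      rw [norm_sub_rev]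
      simpa using norm_add_le (S f) (S g - S f)
    have e4 : δ * (s * ‖f‖) ≤ 1 * (s * ‖f‖) := by gcongr
    calc _ ≤ K * ‖S g‖ := hKE g hg
      _ ≤ K * (2 * (s * ‖f‖)) := by gcongr; linarith
      _ = _ := by ring
  have e5 : ‖S (g - w)‖ ≤ s * (δ * ‖g‖) := (S.le_opNorm _).trans (by gcongr)
  have e6 : ‖S (f - w)‖ ≤ δ * (s * ‖f‖) + s * (δ * ‖g‖) := by
    have : S (f - w) = (S f - S g) + S (g - w) := by simp
    rw [this]
    exact (norm_add_le _ _).trans (add_le_add e2 e5)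
  have e7 : ‖f - w‖ ≤ B * (δ * (s * ‖f‖) + s * (δ * ‖g‖)) :=
    (hB n (f - w) (by rw [map_sub]; exact sub_mem hf hw)).trans (by gcongr)
  calc ‖f - g‖ ≤ ‖f - w‖ + ‖g - w‖ := by
        rw [norm_sub_rev g w]
        simpa using norm_add_le (f - w) (w - g)
    _ ≤ B * (δ * (s * ‖f‖) + s * (δ * ‖g‖)) + δ * ‖g‖ := add_le_add e7 hgw
    _ ≤ B * (δ * (s * ‖f‖) + s * (δ * (2 * K * s * ‖f‖))) + δ * (2 * K * s * ‖f‖) := by gcongr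
    _ = δ * C * ‖f‖ := by rw [hC]; ring
    _ ≤ ε * ‖f‖ := by gcongr

/-- A Galerkin eigenvector close to `L(Δ)` in the form norm has its eigenvalue close to the
spectrum: its approximant `g` in `L(Δ)` satisfies `S (S g) ≈ g / (μ - c)`. -/
theorem eventually_exists_mem_realSpectrum (hA : IsSelfAdjoint A) (hs : IsSemibddOp A)
    {L : ℕ → Submodule ℂ H} (hL : ∀ n, ∀ u ∈ L n, u ∈ formDomain A)
    [∀ n, FiniteDimensional ℂ ((L n).comap S.toLinearMap)]
    (hdense : ∀ f, ∃ w : ℕ → H, (∀ n, w n ∈ (L n).comap S.toLinearMap) ∧ Tendsto w atTop (𝓝 f))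
    {Δ : Set ℝ} {B : ℝ} (hB : 0 < B) (hΔ : ∀ μ ∈ Δ, μ - c ≤ B)
    [FiniteDimensional ℂ (spectralSubspace A Δ)]
    (hGE : AsympContained (fun n => (galerkinSubspace A (L n) Δ).comap S.toLinearMap)
      fun _ => spectralSubspace A Δ) {η : ℝ} (hη : 0 < η) :
    ∀ᶠ n in atTop, ∀ μ ∈ galerkinSpectrum A (L n) ∩ Δ, ∃ t ∈ realSpectrum A ∩ Δ,
      |μ - t| ≤ η := by
  set E := spectralSubspace A Δ with hE
  have hEM : AsympContained (fun _ => E) fun n => (L n).comap S.toLinearMap :=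
    asympContained_of_forall_exists_tendsto fun u _ => hdense u
  set s := ‖S‖ with hsdef
  have hs0 : 0 ≤ s := norm_nonneg _
  -- `|x⁻¹ - y⁻¹| = |x - y| * (x⁻¹ * y⁻¹)` turns distances for `S ∘ S` into distances for `A`
  set ρ := η / B ^ 2 with hρ
  have hρ0 : 0 < ρ := by positivity
  obtain ⟨ε, hε, hε2, hερ⟩ : ∃ ε > 0, ε ≤ 1 / 2 ∧ 8 * s ^ 2 * ε < ρ := by
    refine ⟨min (1 / 2) (ρ / (8 * s ^ 2 + 1)), by positivity, min_le_left _ _, ?_⟩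
    calc _ ≤ 8 * s ^ 2 * (ρ / (8 * s ^ 2 + 1)) := by
          gcongr
          exact min_le_right _ _
      _ < (8 * s ^ 2 + 1) * (ρ / (8 * s ^ 2 + 1)) := by
          gcongr
          linarith
      _ = ρ := by field_simp
  filter_upwards [hGE ε hε, hEM ε hε] with n h1 h2
  rintro μ ⟨⟨u, hu0, hu⟩, hμ⟩
  obtain ⟨f, rfl⟩ := hS.mem_formDomain_iff.1 (hL n u hu.1)
  have hf0 : f ≠ 0 := by
    rintro rfl
    exact hu0 (map_zero S)
  have hfpos : 0 < ‖f‖ := norm_pos_iff.2 hf0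
  have hκ := hS.pos_of_isGalerkinSol hA hs (hL n) hf0 hu
  set M := (L n).comap S.toLinearMap with hM
  set ν := (μ - c)⁻¹ with hν
  have hν0 : 0 < ν := inv_pos.2 hκ
  have hT : compression S M ⟨f, hu.1⟩ = (ν : ℂ) • (⟨f, hu.1⟩ : M) :=
    (hS.isGalerkinSol_iff_compression hA hs (hL n) hκ.ne' ⟨f, hu.1⟩).1 hu
  have hνs : ν ≤ s ^ 2 := by
    have e1 := hS.mul_norm_sq_of_compression_apply_eq hT
    have e2 := pow_le_pow_left₀ (norm_nonneg _) (S.le_opNorm f) 2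
    rw [← e1, mul_pow] at e2
    exact le_of_mul_le_mul_right e2 (pow_pos hfpos 2)
  have hTP : M.starProjection (S (S f)) = (ν : ℂ) • f := congrArg Subtype.val hT
  obtain ⟨g, hg, hfg⟩ := h1 f (Submodule.subset_span ⟨μ, ⟨⟨_, hu0, hu⟩, hμ⟩, hu⟩)
  obtain ⟨w, hw, hgw⟩ := h2 (S (S g))
    (hS.apply_mem_spectralSubspace (hS.apply_mem_spectralSubspace hg))
  have hSS : ∀ y, ‖S (S y)‖ ≤ s ^ 2 * ‖y‖ := fun y => by
    rw [sq, mul_assoc]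
    exact (S.le_opNorm _).trans (by gcongr; exact S.le_opNorm _)
  have hg2 : ‖g‖ ≤ 2 * ‖f‖ := by
    have : ‖g‖ ≤ ‖f‖ + ‖f - g‖ := by
      rw [norm_sub_rev]
      simpa using norm_add_le f (g - f)
    nlinarith
  have hf2 : ‖f‖ ≤ 2 * ‖g‖ := by
    have : ‖f‖ ≤ ‖f - g‖ + ‖g‖ := by simpa using norm_add_le (f - g) g
    nlinarith
  -- residual of `g`
  have hres : ‖S (S g) - (ν : ℂ) • g‖ ≤ 8 * s ^ 2 * ε * ‖g‖ := by
    have e0 : S (S g) - (ν : ℂ) • g = (S (S g) - M.starProjection (S (S g))) +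
        (M.starProjection (S (S (g - f))) + (ν : ℂ) • (f - g)) := by
      rw [map_sub S, map_sub S, map_sub M.starProjection, hTP]
      module
    have e1 : ‖S (S g) - M.starProjection (S (S g))‖ ≤ ε * (s ^ 2 * ‖g‖) := by
      rw [Submodule.starProjection_minimal]
      refine (ciInf_le ⟨0, by rintro _ ⟨v, rfl⟩; exact norm_nonneg _⟩ (⟨w, hw⟩ : M)).trans
        (hgw.trans ?_)
      gcongr
      exact hSS g
    have e2 : ‖M.starProjection (S (S (g - f)))‖ ≤ s ^ 2 * (ε * ‖f‖) := by
      refine (M.norm_starProjection_apply_le _).trans ((hSS _).trans ?_)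
      rw [norm_sub_rev]
      gcongr
    have e3 : ‖(ν : ℂ) • (f - g)‖ ≤ s ^ 2 * (ε * ‖f‖) := by
      rw [norm_smul, Complex.norm_real, Real.norm_of_nonneg hν0.le]
      gcongr
    calc _ ≤ ε * (s ^ 2 * ‖g‖) + (s ^ 2 * (ε * ‖f‖) + s ^ 2 * (ε * ‖f‖)) := by
          rw [e0]
          exact (norm_add_le _ _).trans (add_le_add e1 ((norm_add_le _ _).trans (add_le_add e2 e3)))
      _ ≤ ε * (s ^ 2 * ‖g‖) + (s ^ 2 * (ε * (2 * ‖g‖)) + s ^ 2 * (ε * (2 * ‖g‖))) := by gcongr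
      _ = 5 * (s ^ 2 * ε * ‖g‖) := by ring
      _ ≤ 8 * (s ^ 2 * ε * ‖g‖) := by gcongr; norm_num
      _ = _ := by ring
  have hgpos : 0 < ‖g‖ := by linarith
  -- hence the symmetric operator `S ∘ S` on `E` has an eigenvalue `τ` near `ν`
  let T : E →ₗ[ℂ] E := (S.toLinearMap ∘ₗ S.toLinearMap).restrict fun x hx =>
    hS.apply_mem_spectralSubspace (hS.apply_mem_spectralSubspace hx)
  have hTsym : T.IsSymmetric := fun x y => by
    change inner ℂ (S (S x)) (y : H) = inner ℂ (x : H) (S (S y))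
    rw [hS.inner_left, hS.inner_left]
  obtain ⟨z, hz, hzle⟩ := exists_mem_iSup_eigenspace hTsym ν hρ0.le ⟨g, hg⟩
  have hz0 : z ≠ 0 := by
    rintro rfl
    have e1 : ρ * ‖g‖ ≤ ‖S (S g) - (ν : ℂ) • g‖ := by
      rw [sub_zero] at hzle
      exact hzle
    exact absurd (e1.trans hres) (not_le.2 (by gcongr))
  obtain ⟨τ, hτ, h, hh, hh0⟩ : ∃ τ : ℝ, |τ - ν| < ρ ∧ ∃ h : E, T h = (τ : ℂ) • h ∧ h ≠ 0 := by
    by_contra! hcon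
    refine hz0 ((Submodule.mem_bot ℂ).1 ((iSup₂_le fun τ hτ h hh => ?_ :
      (⨆ t ∈ {t : ℝ | |t - ν| < ρ}, Module.End.eigenspace T (t : ℂ)) ≤ ⊥) hz))
    exact (Submodule.mem_bot ℂ).2 (hcon τ hτ h (Module.End.mem_eigenspace_iff.1 hh))
  have hh0' : (h : H) ≠ 0 := fun e => hh0 (Subtype.ext e)
  have hSh : S (S h) = (τ : ℂ) • (h : H) := congrArg Subtype.val hh
  have hτ0 : τ ≠ 0 := by
    rintro rfl
    rw [Complex.ofReal_zero, zero_smul, ← map_zero S] at hSh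
    have e1 := hS.injective hSh
    rw [← map_zero S] at e1
    exact hh0' (hS.injective e1)
  have hmem : (h : H) ∈ eigenspace A ((c + τ⁻¹ : ℝ) : ℂ) := by
    rw [hS.mem_eigenspace_iff, hSh, smul_smul, add_sub_cancel_left, ← Complex.ofReal_mul,
      inv_mul_cancel₀ hτ0, Complex.ofReal_one, one_smul]
  have htΔ := hS.mem_of_mem_eigenspace_of_mem_spectralSubspace hmem h.2 hh0'
  refine ⟨_, htΔ, ?_⟩
  have hτpos : 0 < τ⁻¹ := by simpa using hS.pos_of_mem_eigenspace hmem hh0'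
  have hτB : τ⁻¹ ≤ B := by simpa using hΔ _ htΔ.2
  have hνB : ν⁻¹ ≤ B := by rw [hν, inv_inv]; exact hΔ μ hμ
  have hdiff : μ - (c + τ⁻¹) = (τ - ν) * (ν⁻¹ * τ⁻¹) := by
    have : μ = c + ν⁻¹ := by rw [hν, inv_inv]; ring
    rw [this]
    field_simp
    ring
  rw [hdiff, abs_mul, abs_of_pos (mul_pos (inv_pos.2 hν0) hτpos)]
  calc _ ≤ ρ * (B * B) := by
        have := inv_pos.2 hν0
        gcongr
    _ = η := by rw [hρ]; field_simp

end IsResolventSqrt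

end Convergence

end Galerkin

/-! ### Convergence of Galerkin eigenspaces and eigenvalues -/

theorem mainTheorem5 {H : Type*} [NormedAddCommGroup H] [InnerProductSpace ℂ H] [CompleteSpace H]
    (A : H →ₗ.[ℂ] H) (hA : IsSelfAdjoint A)
    (hbdd : Galerkin.IsBddOp A ∨ Galerkin.IsSemibddOp A)
    (a b : ℝ) (hab : a < b)
    (ha : (a : ℂ) ∈ Galerkin.resolvent A) (hb : (b : ℂ) ∈ Galerkin.resolvent A)
    (hess : ∀ t ∈ Set.Icc a b, (t : ℂ) ∉ Galerkin.essSpectrum A)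
    (L : ℕ → Submodule ℂ H)
    (hfin : ∀ n, FiniteDimensional ℂ (L n))
    (hdom : ∀ n, ∀ u ∈ L n, u ∈ Galerkin.formDomain A)
    (hdense : ∀ u ∈ Galerkin.formDomain A, ∃ w : ℕ → H, (∀ n, w n ∈ L n) ∧
      Filter.Tendsto (fun n => Galerkin.formNorm A (u - w n)) Filter.atTop (nhds 0))
    (hpoll : ¬ Galerkin.SpectralPollution A L (Set.Icc a b)) :
    (Galerkin.IsBddOp A →
      Filter.Tendsto (fun n => Galerkin.gap (fun u : H => ‖u‖)
        (Galerkin.galerkinSubspace A (L n) (Set.Icc a b))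
        (Galerkin.spectralSubspace A (Set.Icc a b))) Filter.atTop (nhds 0) ∧
      Filter.Tendsto (fun n => Metric.hausdorffEDist
        (Galerkin.galerkinSpectrum A (L n) ∩ Set.Icc a b)
        (Galerkin.realSpectrum A ∩ Set.Icc a b)) Filter.atTop (nhds 0)) ∧
    (Galerkin.IsSemibddOp A →
      Filter.Tendsto (fun n => Galerkin.gap (Galerkin.formNorm A)
        (Galerkin.galerkinSubspace A (L n) (Set.Icc a b))
        (Galerkin.spectralSubspace A (Set.Icc a b))) Filter.atTop (nhds 0) ∧
      Filter.Tendsto (fun n => Metric.hausdorffEDist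
        (Galerkin.galerkinSpectrum A (L n) ∩ Set.Icc a b)
        (Galerkin.realSpectrum A ∩ Set.Icc a b)) Filter.atTop (nhds 0)) := by
  have hs : Galerkin.IsSemibddOp A := hbdd.elim Galerkin.IsBddOp.isSemibddOp id
  obtain ⟨S, hS⟩ := Galerkin.exists_isResolventSqrt hA hs
  set c := Galerkin.specMin A - 1 with hc
  have hN := hS.formNorm_apply hA hs
  set Δ := Set.Icc a b with hΔdef
  set E := Galerkin.spectralSubspace A Δ with hE
  have : FiniteDimensional ℂ E := Galerkin.finiteDimensional_spectralSubspace hess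
  have : ∀ n, FiniteDimensional ℂ ((L n).comap S.toLinearMap) := fun n =>
    hS.finiteDimensional_comap
  have hdense' : ∀ f, ∃ w : ℕ → H, (∀ n, w n ∈ (L n).comap S.toLinearMap) ∧
      Tendsto w atTop (𝓝 f) := by
    intro f
    obtain ⟨w, hw, hlim⟩ := hdense (S f) (hS.mem_formDomain_iff.2 ⟨f, rfl⟩)
    choose g hg using fun n => hS.mem_formDomain_iff.1 (hdom n _ (hw n))
    refine ⟨g, fun n => by rw [Submodule.mem_comap]; exact (hg n).symm ▸ hw n, ?_⟩
    rw [tendsto_iff_norm_sub_tendsto_zero]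
    refine hlim.congr fun n => ?_
    rw [← hg, ← map_sub, hN, norm_sub_rev]
  -- the points of the spectrum in `Δ` are interior points, as `a` and `b` are regular
  have hnhds : ∀ t ∈ Galerkin.realSpectrum A ∩ Δ, Δ ∈ 𝓝 t := fun t ht => by
    refine Icc_mem_nhds (ht.2.1.lt_of_ne ?_) (ht.2.2.lt_of_ne ?_)
    · rintro rfl
      exact ht.1 ha
    · rintro rfl
      exact ht.1 hb
  have hEG : Galerkin.AsympContained (fun _ => E)
      fun n => (Galerkin.galerkinSubspace A (L n) Δ).comap S.toLinearMap := by
    have hle : E ≤ Galerkin.limitSubspace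
        fun n => (Galerkin.galerkinSubspace A (L n) Δ).comap S.toLinearMap :=
      iSup₂_le fun t ht u hu =>
        hS.exists_tendsto_of_mem_eigenspace hA hs hdom hdense' (hnhds t ht) hu
    exact Galerkin.asympContained_of_forall_exists_tendsto fun u hu => hle hu
  have hXE : Galerkin.AsympContained (fun n => Galerkin.galerkinSubspace A (L n) Δ) fun _ => E :=
    Galerkin.asympContained_of_tendsto_semiGap (not_not.1 hpoll)
  -- the maximum keeps the bound positive when `b ≤ c`
  have hB : 0 < max (b - c) 1 := lt_max_of_lt_right one_pos
  have hBΔ : ∀ μ ∈ Δ, μ - c ≤ max (b - c) 1 := fun μ hμ =>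
    (sub_le_sub_right hμ.2 c).trans (le_max_left _ _)
  have hGE : Galerkin.AsympContained
      (fun n => (Galerkin.galerkinSubspace A (L n) Δ).comap S.toLinearMap) fun _ => E := by
    refine hS.asympContained_comap
      (fun u hu => hS.exists_apply_eq_of_mem_spectralSubspace hu) (B := √(max (b - c) 1))
      (fun n f hf => ?_) (Real.sqrt_nonneg _) hXE hEG
    have h := (hS.norm_sq_le_of_mem_galerkinSubspace hA hs (hdom n) hB hBΔ hf).2
    refine abs_le_of_sq_le_sq' ?_ (by positivity) |>.2
    rwa [mul_pow, Real.sq_sqrt hB.le]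
  have hH : Tendsto (fun n => Metric.hausdorffEDist (Galerkin.galerkinSpectrum A (L n) ∩ Δ)
      (Galerkin.realSpectrum A ∩ Δ)) atTop (𝓝 0) := by
    refine Galerkin.tendsto_hausdorffEDist_zero (Galerkin.finite_realSpectrum_inter hess)
      (fun η hη => hS.eventually_exists_mem_realSpectrum hA hs hdom hdense' hB hBΔ hGE hη)
      fun η hη t ht => ?_
    obtain ⟨-, -, hne, -⟩ := Galerkin.mem_discreteSpectrum hess ht
    obtain ⟨u, hu, hu0⟩ := Submodule.exists_mem_ne_zero_of_ne_bot hne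
    obtain ⟨w, hw, hlim⟩ := hS.exists_tendsto_of_mem_eigenspace hA hs hdom hdense'
      (Filter.inter_mem (hnhds t ht) (Metric.closedBall_mem_nhds t hη)) hu
    filter_upwards [hlim.eventually_ne hu0] with n hn
    obtain ⟨μ, hμ, hμΔ, hμη⟩ := Galerkin.galerkinSpectrum_inter_nonempty (hw n)
      (norm_pos_iff.1 (hS.norm_pos hn))
    exact ⟨μ, ⟨hμ, hμΔ⟩, hμη⟩
  refine ⟨fun _ => ⟨?_, hH⟩, fun _ => ⟨?_, hH⟩⟩
  · have hEX : Galerkin.AsympContained (fun _ => E)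
        fun n => Galerkin.galerkinSubspace A (L n) Δ := by
      obtain ⟨K, hK, hKE⟩ := hS.exists_norm_le E
      intro ε hε
      have hδ : 0 < ε / (K * (‖S‖ + 1)) := by positivity
      filter_upwards [hEG _ hδ] with n hn u hu
      obtain ⟨g, hg, rfl⟩ := hS.exists_apply_eq_of_mem_spectralSubspace hu
      obtain ⟨w, hw, hle⟩ := hn g hg
      refine ⟨S w, hw, ?_⟩
      rw [← map_sub]
      calc _ ≤ ‖S‖ * ‖g - w‖ := S.le_opNorm _
        _ ≤ (‖S‖ + 1) * (ε / (K * (‖S‖ + 1)) * (K * ‖S g‖)) := by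
          gcongr
          · linarith
          · exact hle.trans (by gcongr; exact hKE g hg)
        _ = ε * ‖S g‖ := by field_simp
    simpa only [Galerkin.gap, max_self] using (not_not.1 hpoll).max hEX.tendsto_semiGap
  · have hX : ∀ n, ∀ u ∈ Galerkin.galerkinSubspace A (L n) Δ, u ∈ Galerkin.formDomain A :=
      fun n u hu => hdom n u ((Submodule.span_le.2 (by rintro v ⟨μ, -, hv⟩; exact hv.1) :
        Galerkin.galerkinSubspace A (L n) Δ ≤ L n) hu)
    have hcomap := hS.comap_spectralSubspace Δ
    have h1 := hS.tendsto_semiGap_formNorm hN hX (Y := fun _ => E) (by rwa [hcomap])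
    have h2 := hS.tendsto_semiGap_formNorm hN (X := fun _ => E)
      (Y := fun n => Galerkin.galerkinSubspace A (L n) Δ) (fun n u hu => by
        obtain ⟨g, -, rfl⟩ := hS.exists_apply_eq_of_mem_spectralSubspace hu
        exact hS.mem_formDomain_iff.2 ⟨g, rfl⟩) (by rwa [hcomap])
    simpa only [Galerkin.gap, max_self] using h1.max h2
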